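/- Let $K$ be a field and let $E=(E^0,E^1,r,s)$ be a finite directed graph (finitely many vertices and edges; loops and parallel edges are allowed; $s(e)$ and $r(e)$ are the source and the range of an edge $e$). A vertex is a \emph{sink} if no edge starts at it, and a \emph{source} if no edge ends at it. Let $\overline E$ be the (possibly empty) graph obtained from $E$ by repeatedly removing all sources and all sinks, together with all edges incident to a removed vertex, until no sources and no sinks remain. Let $L_K(E)$ be the Leavitt path algebra: the unital $K$-algebra generated by the $v\in E^0$ and $e,e^*$ for $e\in E^1$, subject to $vw=\delta_{v,w}v$ for $v,w\in E^0$; $s(e)e=e=e\,r(e)$ and $r(e)e^*=e^*=e^*s(e)$ for $e\in E^1$; $e^*f=\delta_{e,f}r(e)$ for $e,f\in E^1$; $v=\sum_{s(e)=v}ee^*$ for every $v\in E^0$ that is not a sink; and $\sum_{v\in E^0}v=1$. For a ring $A$ let $A\text{-Mod}$ be the category of left $A$-modules. Then there is a recollement of abelian categories $$L_K(\overline E)\text{-Mod}\;\longrightarrow\;L_K(E)\text{-Mod}\;\longrightarrow\;\Big(\bigoplus_{\text{sinks of }E}K\Big)\text{-Mod},$$ that is, there are functors $i:L_K(\overline E)\text{-Mod}\to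 L_K(E)\text{-Mod}$, $j:L_K(E)\text{-Mod}\to(\bigoplus_{\text{sinks of }E}K)\text{-Mod}$, functors $q,p:L_K(E)\text{-Mod}\to L_K(\overline E)\text{-Mod}$ and functors $s,r:(\bigoplus_{\text{sinks of }E}K)\text{-Mod}\to L_K(E)\text{-Mod}$ such that (i) $q$ is left adjoint and $p$ is right adjoint to $i$, and $s$ is left adjoint and $r$ is right adjoint to $j$; (ii) $i$, $s$ and $r$ are fully faithful; (iii) a module $M$ is isomorphic to one in the image of $i$ if and only if $j(M)=0$. Here $\bigoplus_{\text{sinks of }E}K$ is a ring with componentwise operations. -/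

import Mathlib

open CategoryTheory CategoryTheory.Limits

universe u v w

/-- A directed graph `(E⁰, E¹, r, s)`: a type of vertices, a type of edges, and the source and
range maps. Loops and parallel edges are allowed. -/
structure DirectedGraph where
  /-- the vertices -/
  Vert : Type u
  /-- the edges -/
  Edge : Type v
  /-- the source of an edge -/
  src : Edge → Vert
  /-- the range of an edge -/
  rng : Edge → Vert

namespace DirectedGraph

/-- A sink emits no edge. -/
def IsSink (G : DirectedGraph.{u, v}) (x : G.Vert) : Prop := ∀ e : G.Edge, G.src e ≠ x

/-- A source receives no edge. -/
def IsSource (G : DirectedGraph.{u, v}) (x : G.Vert) : Prop := ∀ e : G.Edge, G.rng e ≠ x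

/-- The graph that remains when the vertices outside `W` are removed, together with all edges that
start or end at a removed vertex. -/
def induce (G : DirectedGraph.{u, v}) (W : Set G.Vert) : DirectedGraph.{u, v} where
  Vert := {x : G.Vert // x ∈ W}
  Edge := {e : G.Edge // G.src e ∈ W ∧ G.rng e ∈ W}
  src e := ⟨G.src e.1, e.2.1⟩
  rng e := ⟨G.rng e.1, e.2.2⟩

instance finite_vert_induce (G : DirectedGraph.{u, v}) [Finite G.Vert] (W : Set G.Vert) :
    Finite (G.induce W).Vert :=
  inferInstanceAs (Finite {x : G.Vert // x ∈ W})

instance finite_edge_induce (G : DirectedGraph.{u, v}) [Finite G.Edge] (W : Set G.Vert) :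
    Finite (G.induce W).Edge :=
  inferInstanceAs (Finite {e : G.Edge // G.src e ∈ W ∧ G.rng e ∈ W})

/-- The vertices that are left after `n` rounds, where each round removes all the sources and all
the sinks of the graph that the previous rounds have left. -/
def remaining (G : DirectedGraph.{u, v}) : ℕ → Set G.Vert
  | 0 => Set.univ
  | n + 1 => {x | ∃ h : x ∈ G.remaining n,
      ¬ (G.induce (G.remaining n)).IsSink ⟨x, h⟩ ∧ ¬ (G.induce (G.remaining n)).IsSource ⟨x, h⟩}

/-- The graph obtained by repeatedly removing all sources and sinks: it is spanned by the vertices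
that survive every round. -/
def removeSourcesSinks (G : DirectedGraph.{u, v}) : DirectedGraph.{u, v} :=
  G.induce (⋂ n, G.remaining n)

instance finite_vert_removeSourcesSinks (G : DirectedGraph.{u, v}) [Finite G.Vert] :
    Finite G.removeSourcesSinks.Vert :=
  finite_vert_induce G _

instance finite_edge_removeSourcesSinks (G : DirectedGraph.{u, v}) [Finite G.Edge] :
    Finite G.removeSourcesSinks.Edge :=
  finite_edge_induce G _

/-- The generators of the Leavitt path algebra: vertices `x`, edges `e`, ghost edges `e*`. -/
inductive Generator (G : DirectedGraph.{u, v}) : Type (max u v)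
  | vert : G.Vert → Generator G
  | edge : G.Edge → Generator G
  | ghost : G.Edge → Generator G

section Leavitt

variable (K : Type w) [Field K] (G : DirectedGraph.{u, v})

/-- The vertex `x` in the free algebra on the generators. -/
def vertElt (x : G.Vert) : FreeAlgebra K G.Generator := FreeAlgebra.ι K (Generator.vert x)

/-- The edge `e` in the free algebra on the generators. -/
def edgeElt (e : G.Edge) : FreeAlgebra K G.Generator := FreeAlgebra.ι K (Generator.edge e)

/-- The ghost edge `e*` in the free algebra on the generators. -/
def ghostElt (e : G.Edge) : FreeAlgebra K G.Generator := FreeAlgebra.ι K (Generator.ghost e)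

/-- The defining relations of the Leavitt path algebra of a finite graph. Since there are only
finitely many vertices, the algebra is unital with identity the sum of all vertices; this is the
last relation. -/
inductive LeavittRel : FreeAlgebra K G.Generator → FreeAlgebra K G.Generator → Prop
  | vert_mul_self (x : G.Vert) :
      LeavittRel (vertElt K G x * vertElt K G x) (vertElt K G x)
  | vert_mul_of_ne (x y : G.Vert) (h : x ≠ y) :
      LeavittRel (vertElt K G x * vertElt K G y) 0
  | src_mul_edge (e : G.Edge) :
      LeavittRel (vertElt K G (G.src e) * edgeElt K G e) (edgeElt K G e)
  | edge_mul_rng (e : G.Edge) :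
      LeavittRel (edgeElt K G e * vertElt K G (G.rng e)) (edgeElt K G e)
  | rng_mul_ghost (e : G.Edge) :
      LeavittRel (vertElt K G (G.rng e) * ghostElt K G e) (ghostElt K G e)
  | ghost_mul_src (e : G.Edge) :
      LeavittRel (ghostElt K G e * vertElt K G (G.src e)) (ghostElt K G e)
  | ghost_mul_self (e : G.Edge) :
      LeavittRel (ghostElt K G e * edgeElt K G e) (vertElt K G (G.rng e))
  | ghost_mul_of_ne (e f : G.Edge) (h : e ≠ f) :
      LeavittRel (ghostElt K G e * edgeElt K G f) 0
  | vert_eq_sum (x : G.Vert) (h : ¬ G.IsSink x) :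
      LeavittRel (vertElt K G x)
        (∑ᶠ e : {e : G.Edge // G.src e = x}, edgeElt K G e.1 * ghostElt K G e.1)
  | sum_vert :
      LeavittRel (∑ᶠ x : G.Vert, vertElt K G x) 1

/-- The Leavitt path algebra `L_K(G)` of a finite graph `G` over a field `K`, as a unital
`K`-algebra. -/
abbrev LeavittPathAlgebra [Finite G.Vert] [Finite G.Edge] : Type (max u v w) :=
  RingQuot (LeavittRel K G)

end Leavitt

end DirectedGraph

/-- A recollement of abelian categories
```
       p              r
    <-----         <-----
  𝒜 --i--> ℬ --j--> 𝒞
    <-----         <-----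
       q              s
```
(The functors, being adjoints, are automatically additive.) -/
structure Recollement (𝒜 ℬ 𝒞 : Type*) [Category* 𝒜] [Category* ℬ] [Category* 𝒞]
    [Abelian 𝒜] [Abelian ℬ] [Abelian 𝒞] where
  /-- the inclusion -/
  i : 𝒜 ⥤ ℬ
  /-- the right adjoint of `i` -/
  p : ℬ ⥤ 𝒜
  /-- the left adjoint of `i` -/
  q : ℬ ⥤ 𝒜
  /-- the quotient functor -/
  j : ℬ ⥤ 𝒞
  /-- the right adjoint of `j` -/
  r : 𝒞 ⥤ ℬ
  /-- the left adjoint of `j` -/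
  s : 𝒞 ⥤ ℬ
  /-- `s ⊣ j` -/
  adj_s_j : s ⊣ j
  /-- `j ⊣ r` -/
  adj_j_r : j ⊣ r
  /-- `q ⊣ i` -/
  adj_q_i : q ⊣ i
  /-- `i ⊣ p` -/
  adj_i_p : i ⊣ p
  /-- `i` is fully faithful -/
  fullyFaithful_i : i.FullyFaithful
  /-- `s` is fully faithful -/
  fullyFaithful_s : s.FullyFaithful
  /-- `r` is fully faithful -/
  fullyFaithful_r : r.FullyFaithful
  /-- `Im i = Ker j`: an object is isomorphic to one in the image of `i` iff `j` kills it -/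
  essImage_i_iff : ∀ X : ℬ, i.essImage X ↔ IsZero (j.obj X)

/-! Let L be the Leavitt path algebra of E and ε ∈ L the sum of the sinks. An idempotent always
gives a recollement of L/LεL-Mod, L-Mod and εLε-Mod, so the task is to identify the two outer rings
up to Morita equivalence.

The corner εLε is a product of copies of K. For a sink x, x·e = 0 for every edge e, and a ghost edge
times an edge is a vertex or 0, so the right ideal xL is spanned by ghost paths (`ghostSpan_mul`).
Multiplying on the right by a sink y kills every nonempty ghost path, so xLy is K·x if x = y and
zero otherwise (`exists_lVert_mul_mul_lVert`). Vertices are nonzero in L because L acts on the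
functions on E⁰ × ℕ through a branching system (`lVert_ne_zero`).

For the quotient, if all sinks act as zero on a module, then so does every vertex that starts no
infinite path (`lVert_smul_eq_zero`). Hence the kernel of M ↦ εM consists of the modules over the
Leavitt path algebra of the subgraph spanned by the vertices that do start one
(`essImage_restrictScalars_killHom_iff`). This subgraph has no sinks. Removing its sources, round
after round, leaves the same vertices as removing sources and sinks of E together. Each round passes
to a full corner, hence to a Morita equivalent ring: since ∑ S_e T_e = 1, an element a is determined
by the matrix (T_e a S_{e'}), whose entries already lie in the algebra of the smaller graph
(`cutHom_matrixHom_apply`, `matrixHom_cutHom_apply`).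

Right adjoints are given by coinduction. Left adjoints are not built from tensor products: the
functors preserve limits, and the special adjoint functor theorem applies. The left adjoint of the
corner functor is fully faithful because the right adjoint is. -/

section Retract

/-! ### Limits and retracts of functors. -/

variable {C : Type*} [Category* C] {D : Type*} [Category* D] {J : Type*} [Category* J]

/-- A retract of a functor that preserves a limit preserves this limit. -/
lemma preservesLimit_of_retract {F G : C ⥤ D} (a : F ⟶ G) (b : G ⟶ F) (hab : a ≫ b = 𝟙 F)
    (H : J ⥤ C) [PreservesLimit H G] : PreservesLimit H F where
  preserves {c} hc := ⟨by
    have hab' (X : C) : a.app X ≫ b.app X = 𝟙 _ := by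
      rw [← NatTrans.comp_app, hab, NatTrans.id_app]
    let hG := isLimitOfPreserves G hc
    -- Push a cone into `G` along `a`, lift it there, and come back along `b`.
    let K (s : Cone (H ⋙ F)) : Cone (H ⋙ G) :=
      (Cone.postcompose (Functor.whiskerLeft H a)).obj s
    exact
      { lift := fun s => hG.lift (K s) ≫ b.app c.pt
        fac := fun s j => by
          have := hG.fac (K s) j
          simp only [Functor.mapCone_π_app] at this
          simp only [Functor.mapCone_π_app, Category.assoc, ← b.naturality]
          rw [← Category.assoc, this]
          simp [K, hab']
        uniq := fun s f hf => by
          have : f ≫ a.app c.pt = hG.lift (K s) := by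
            refine hG.uniq (K s) _ fun j => ?_
            have := hf j
            simp only [Functor.mapCone_π_app] at this
            simp only [Functor.mapCone_π_app, Category.assoc, ← a.naturality]
            rw [← Category.assoc, this]
            simp [K]
          rw [← this, Category.assoc, hab']
          exact (Category.comp_id f).symm }⟩

end Retract

/-! ### Corner functors, their adjoints, and Morita equivalence for full corners. -/

section CornerFunctor

variable {B : Type v} {R : Type u} [Ring B] [Ring R] (σ : B →ₙ+* R)

lemma NonUnitalRingHom.map_mul_map_one (b : B) : σ b * σ 1 = σ b := by rw [← map_mul, mul_one]

lemma NonUnitalRingHom.map_one_mul_map (b : B) : σ 1 * σ b = σ b := by rw [← map_mul, one_mul]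

/-- The part of a module on which the idempotent `σ 1` acts as the identity. -/
def cornerPart (M : Type*) [AddCommGroup M] [Module R M] : AddSubgroup M where
  carrier := {m | σ 1 • m = m}
  add_mem' {x y} hx hy := by
    change σ 1 • (x + y) = x + y
    rw [smul_add, show σ 1 • x = x from hx, show σ 1 • y = y from hy]
  zero_mem' := smul_zero _
  neg_mem' {x} hx := by
    change σ 1 • (-x) = -x
    rw [smul_neg, show σ 1 • x = x from hx]

lemma mem_cornerPart {M : Type*} [AddCommGroup M] [Module R M] {m : M} :
    m ∈ cornerPart σ M ↔ σ 1 • m = m := Iff.rfl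

lemma map_smul_mem_cornerPart {M : Type*} [AddCommGroup M] [Module R M] (b : B) (m : M) :
    σ b • m ∈ cornerPart σ M := by
  rw [mem_cornerPart, smul_smul, σ.map_one_mul_map]

/-- The action is unital although `σ` need not be: `σ 1` acts as the identity on this subgroup. -/
instance cornerPartModule (M : Type*) [AddCommGroup M] [Module R M] :
    Module B (cornerPart σ M) where
  smul b m := ⟨σ b • m.1, map_smul_mem_cornerPart σ b m.1⟩
  one_smul m := Subtype.ext m.2
  mul_smul a b m := Subtype.ext (by
    change σ (a * b) • m.1 = σ a • σ b • m.1
    rw [map_mul, mul_smul])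
  smul_zero a := Subtype.ext (smul_zero _)
  smul_add a m n := Subtype.ext (smul_add _ _ _)
  add_smul a b m := Subtype.ext (by
    change σ (a + b) • m.1 = σ a • m.1 + σ b • m.1
    rw [map_add, add_smul])
  zero_smul m := Subtype.ext (by
    change σ 0 • m.1 = 0
    rw [map_zero, zero_smul])

@[simp]
lemma coe_smul_cornerPart {M : Type*} [AddCommGroup M] [Module R M] (b : B)
    (m : cornerPart σ M) : ((b • m : cornerPart σ M) : M) = σ b • (m : M) := rfl

/-- The map induced by a linear map on the corner parts. -/
def cornerPartMap {M N : Type*} [AddCommGroup M] [Module R M] [AddCommGroup N] [Module R N]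
    (f : M →ₗ[R] N) : cornerPart σ M →ₗ[B] cornerPart σ N where
  toFun m := ⟨f m.1, by rw [mem_cornerPart, ← map_smul, (mem_cornerPart σ).1 m.2]⟩
  map_add' m n := Subtype.ext (map_add f _ _)
  map_smul' b m := Subtype.ext (map_smul f _ _)

/-- The functor `M ↦ σ(1) M`. -/
def cornerFunctor : ModuleCat.{w} R ⥤ ModuleCat.{w} B where
  obj M := ModuleCat.of B (cornerPart σ M)
  map f := ModuleCat.ofHom (cornerPartMap σ f.hom)

/-- The additive maps `φ : R → V` with `φ (σ b * a) = b • φ a`. -/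
def coinduced (V : Type*) [AddCommGroup V] [Module B V] : AddSubgroup (R →+ V) where
  carrier := {φ | ∀ b a, φ (σ b * a) = b • φ a}
  add_mem' {φ ψ} hφ hψ b a := by
    rw [AddMonoidHom.add_apply, AddMonoidHom.add_apply, hφ, hψ, smul_add]
  zero_mem' b a := (smul_zero b).symm
  neg_mem' {φ} hφ b a := by rw [AddMonoidHom.neg_apply, AddMonoidHom.neg_apply, hφ, smul_neg]

instance coinducedModule (V : Type*) [AddCommGroup V] [Module B V] :
    Module R (coinduced σ V) where
  smul r φ := ⟨φ.1.comp (AddMonoidHom.mulRight r), fun b a => by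
    change φ.1 (σ b * a * r) = b • φ.1 (a * r)
    rw [mul_assoc, φ.2]⟩
  one_smul φ := Subtype.ext (AddMonoidHom.ext fun a => congrArg φ.1 (mul_one a))
  mul_smul r s φ := Subtype.ext (AddMonoidHom.ext fun a => congrArg φ.1 (mul_assoc a r s).symm)
  smul_zero r := rfl
  smul_add r φ ψ := rfl
  add_smul r s φ := Subtype.ext (AddMonoidHom.ext fun a => by
    change φ.1 (a * (r + s)) = φ.1 (a * r) + φ.1 (a * s)
    rw [mul_add, map_add])
  zero_smul φ := Subtype.ext (AddMonoidHom.ext fun a => by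
    change φ.1 (a * 0) = 0
    rw [mul_zero, map_zero])

lemma smul_coinduced_apply {V : Type*} [AddCommGroup V] [Module B V] (r : R)
    (φ : coinduced σ V) (a : R) : (r • φ).1 a = φ.1 (a * r) := rfl

/-- The map induced by a linear map on the coinduced modules. -/
def coinducedMap {V W : Type*} [AddCommGroup V] [Module B V] [AddCommGroup W] [Module B W]
    (f : V →ₗ[B] W) : coinduced σ V →ₗ[R] coinduced σ W where
  toFun φ := ⟨f.toAddMonoidHom.comp φ.1, fun b a => by
    change f (φ.1 (σ b * a)) = b • f (φ.1 a)
    rw [φ.2, map_smul]⟩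
  map_add' φ ψ := Subtype.ext (AddMonoidHom.ext fun a => map_add f _ _)
  map_smul' r φ := rfl

/-- The right adjoint of the corner functor. -/
def coinducedFunctor : ModuleCat.{max u w} B ⥤ ModuleCat.{max u w} R where
  obj V := ModuleCat.of R (coinduced σ V)
  map f := ModuleCat.ofHom (coinducedMap σ f.hom)

/-- The adjunction between the corner functor and coinduction, on homomorphisms. -/
def cornerHomEquiv (M V : Type*) [AddCommGroup M] [Module R M] [AddCommGroup V] [Module B V] :
    (cornerPart σ M →ₗ[B] V) ≃ (M →ₗ[R] coinduced σ V) where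
  toFun f :=
    { toFun := fun m => ⟨
        { toFun := fun a => f ⟨σ 1 • a • m, map_smul_mem_cornerPart σ _ _⟩
          map_zero' := by
            rw [← map_zero f]; congr 1; exact Subtype.ext (by simp)
          map_add' := fun a b => by
            rw [← map_add]; congr 1; exact Subtype.ext (by simp [add_smul]) },
        fun b a => by
          change f _ = b • f _
          rw [← map_smul]; congr 1
          exact Subtype.ext (by
            simp only [coe_smul_cornerPart, smul_smul, ← mul_assoc, σ.map_one_mul_map,
              σ.map_mul_map_one])⟩
      map_add' := fun m n => Subtype.ext (AddMonoidHom.ext fun a => by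
        change f _ = f _ + f _
        rw [← map_add]; congr 1; exact Subtype.ext (by simp))
      map_smul' := fun r m => Subtype.ext (AddMonoidHom.ext fun a => by
        change f _ = f _
        congr 1; exact Subtype.ext (by simp [smul_smul])) }
  invFun g :=
    { toFun := fun m => (g m.1).1 1
      map_add' := fun m n => by simp
      map_smul' := fun b m => by
        rw [coe_smul_cornerPart, map_smul, smul_coinduced_apply, one_mul, RingHom.id_apply,
          ← (g m.1).2, mul_one] }
  left_inv f := LinearMap.ext fun m => by
    change f _ = f _
    congr 1
    refine Subtype.ext ?_
    change σ 1 • (1 : R) • (m : M) = m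
    rw [one_smul, (mem_cornerPart σ).1 m.2]
  right_inv g := LinearMap.ext fun m => Subtype.ext (AddMonoidHom.ext fun a => by
    change (g (σ 1 • a • m)).1 1 = (g m).1 a
    rw [map_smul, map_smul, smul_coinduced_apply, smul_coinduced_apply, one_mul, (g m).2,
      one_smul])

/-- The adjunction between the corner functor and coinduction. -/
def cornerAdjunction : cornerFunctor.{u, v, max u w} σ ⊣ coinducedFunctor.{u, v, w} σ :=
  Adjunction.mkOfHomEquiv
    { homEquiv := fun M V => ModuleCat.homEquiv.trans
        ((cornerHomEquiv σ M V).trans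
          (ModuleCat.homEquiv (M := M) (N := ModuleCat.of R (coinduced σ V))).symm)
      homEquiv_naturality_left_symm := fun _ _ => rfl
      homEquiv_naturality_right := fun _ _ => rfl }

/-- The inclusion of the corner part of a module. -/
def cornerInclusion :
    cornerFunctor.{u, v, w} σ ⋙ forget₂ (ModuleCat B) AddCommGrpCat ⟶
      forget₂ (ModuleCat R) AddCommGrpCat where
  app M := AddCommGrpCat.ofHom (cornerPart σ M).subtype
  naturality _ _ _ := rfl

/-- The projection of a module onto its corner part. -/
def cornerProjection :
    forget₂ (ModuleCat R) AddCommGrpCat ⟶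
      cornerFunctor.{u, v, w} σ ⋙ forget₂ (ModuleCat B) AddCommGrpCat where
  app M := AddCommGrpCat.ofHom
    { toFun := fun m : M => (⟨σ 1 • m, map_smul_mem_cornerPart σ _ _⟩ : cornerPart σ M)
      map_zero' := Subtype.ext (smul_zero _)
      map_add' := fun x y => Subtype.ext (smul_add _ _ _) }
  naturality M N f := by
    ext m
    exact Subtype.ext (map_smul f.hom (σ 1) (show M from m)).symm

/-- On underlying abelian groups, m ↦ σ(1)m splits the inclusion of the corner part, so the functor
becomes a retract of the forgetful functor, which preserves limits. The forgetful functor from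
`B`-modules reflects them. -/
instance preservesLimits_cornerFunctor : PreservesLimits (cornerFunctor.{u, v, w} σ) := by
  have : PreservesLimits
      (cornerFunctor.{u, v, w} σ ⋙ forget₂ (ModuleCat.{w} B) AddCommGrpCat.{w}) :=
    ⟨⟨fun {H} => preservesLimit_of_retract (cornerInclusion σ) (cornerProjection σ) (by
      ext M m
      exact Subtype.ext m.2) H⟩⟩
  exact preservesLimits_of_reflects_of_preserves _ (forget₂ (ModuleCat.{w} B) AddCommGrpCat.{w})

/-- The special adjoint functor theorem: a module category has a coseparator. -/
lemma ModuleCat.isRightAdjoint_of_preservesLimits {S : Type u} [Ring S] {D : Type*}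
    [Category.{u} D] (F : ModuleCat.{u} S ⥤ D) [PreservesLimits F] : F.IsRightAdjoint :=
  isRightAdjoint_of_preservesLimits_of_isCoseparating
    (isCoseparator_coseparator (ModuleCat.{u} S)) F

instance isRightAdjoint_cornerFunctor : (cornerFunctor.{u, v, u} σ).IsRightAdjoint :=
  ModuleCat.isRightAdjoint_of_preservesLimits _

/-- `σ` identifies `B` with the corner ring `σ(1) R σ(1)`. -/
structure IsCornerEmbedding : Prop where
  injective : Function.Injective σ
  exists_eq : ∀ a, ∃ b, σ b = σ 1 * a * σ 1

variable {σ}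

/-- The counit is evaluation φ ↦ φ(1). Let θ(a) ∈ B correspond to σ(1) a σ(1). If φ is fixed by
σ(1), then φ(a) = φ(aσ(1)) = φ(σ(1)aσ(1)) = θ(a)φ(1), so φ(1) determines φ. Conversely a ↦ θ(a)x is
such a φ, with value x at 1. -/
lemma IsCornerEmbedding.bijective_counit (h : IsCornerEmbedding σ) (V : Type*) [AddCommGroup V]
    [Module B V] :
    Function.Bijective ((cornerHomEquiv σ (coinduced σ V) V).symm LinearMap.id) := by
  choose θ hθ using h.exists_eq
  constructor
  · rw [injective_iff_map_eq_zero]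
    intro φ hφ
    have h1 : φ.1.1 1 = 0 := hφ
    refine Subtype.ext (Subtype.ext (AddMonoidHom.ext fun a => ?_))
    have h2 : φ.1.1 a = φ.1.1 (a * σ 1) :=
      (DFunLike.congr_fun (congrArg Subtype.val φ.2) a).symm
    have h3 : φ.1.1 (a * σ 1) = φ.1.1 (σ 1 * (a * σ 1)) := by rw [φ.1.2, one_smul]
    rw [h2, h3, ← mul_assoc, ← hθ, ← mul_one (σ _), φ.1.2, h1, smul_zero]
    rfl
  · intro x
    have hadd (a b : R) : θ (a + b) = θ a + θ b :=
      h.injective (by rw [map_add, hθ, hθ, hθ, mul_add, add_mul])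
    have hmul (b : B) (a : R) : θ (σ b * a) = b * θ a :=
      h.injective (by
        rw [map_mul, hθ, hθ, ← mul_assoc, ← mul_assoc, ← mul_assoc, σ.map_one_mul_map,
          σ.map_mul_map_one])
    let φ : coinduced σ V := ⟨AddMonoidHom.mk' (fun a => θ a • x) fun a b => by
      rw [hadd, add_smul], fun b a => by
        change θ (σ b * a) • x = b • θ a • x
        rw [hmul, mul_smul]⟩
    have hφ : σ 1 • φ = φ := Subtype.ext (AddMonoidHom.ext fun a => by
      change θ (a * σ 1) • x = θ a • x
      congr 1
      apply h.injective
      rw [hθ, hθ, mul_assoc, mul_assoc, mul_assoc, σ.map_one_mul_map])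
    refine ⟨⟨φ, hφ⟩, ?_⟩
    change θ 1 • x = x
    have : θ 1 = 1 := h.injective (by rw [hθ, mul_one, σ.map_one_mul_map])
    rw [this, one_smul]

lemma IsCornerEmbedding.isIso_counit (h : IsCornerEmbedding σ) :
    IsIso (cornerAdjunction.{u, v, w} σ).counit := by
  have (V : ModuleCat.{max u w} B) : IsIso ((cornerAdjunction.{u, v, w} σ).counit.app V) := by
    rw [ConcreteCategory.isIso_iff_bijective]
    exact h.bijective_counit V
  exact NatIso.isIso_of_isIso_app _

/-- Coinduction along a corner embedding is fully faithful. -/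
noncomputable def IsCornerEmbedding.fullyFaithfulCoinduced (h : IsCornerEmbedding σ) :
    (coinducedFunctor.{u, v, w} σ).FullyFaithful :=
  haveI := h.isIso_counit
  (cornerAdjunction σ).fullyFaithfulROfIsIsoCounit

/-- The corner functor of a full corner is faithful. -/
lemma faithful_cornerFunctor (hfull : Ideal.span {a | ∃ x y, a = x * σ 1 * y} = ⊤) :
    (cornerFunctor.{u, v, w} σ).Faithful where
  map_injective {M N f g} hfg := by
    ext m
    -- The difference is killed by σ(1)R, hence by Rσ(1)R, which contains 1.
    have h (a : R) : σ 1 • a • (f.hom m - g.hom m) = 0 := by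
      have := congrArg (fun t : ↥(cornerPart σ N) => (t : N)) (DFunLike.congr_fun
        (congrArg ModuleCat.Hom.hom hfg) ⟨σ 1 • a • m, map_smul_mem_cornerPart σ _ _⟩)
      have h' : f.hom (σ 1 • a • m) = g.hom (σ 1 • a • m) := this
      rw [smul_sub, smul_sub, sub_eq_zero, ← map_smul, ← map_smul, ← map_smul, ← map_smul, h']
    have h1 : (1 : R) ∈ Ideal.span {a | ∃ x y, a = x * σ 1 * y} := hfull ▸ Submodule.mem_top
    have key : ∀ r ∈ Ideal.span {a | ∃ x y, a = x * σ 1 * y}, r • (f.hom m - g.hom m) = 0 := by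
      intro r hr
      induction hr using Submodule.span_induction with
      | mem r hr =>
        obtain ⟨x, y, rfl⟩ := hr
        rw [mul_smul, mul_smul, h, smul_zero]
      | zero => exact zero_smul _ _
      | add x y _ _ hx hy => rw [add_smul, hx, hy, add_zero]
      | smul a x _ hx => rw [smul_eq_mul, mul_smul, hx, smul_zero]
    have := key 1 h1
    rw [one_smul, sub_eq_zero] at this
    exact this

/-- A full corner of a ring is Morita equivalent to the ring. -/
lemma IsCornerEmbedding.isEquivalence (h : IsCornerEmbedding σ)
    (hfull : Ideal.span {a | ∃ x y, a = x * σ 1 * y} = ⊤) :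
    (cornerFunctor.{u, v, max u w} σ).IsEquivalence := by
  have := h.isIso_counit.{u, v, w}
  have := faithful_cornerFunctor.{u, v, max u w} hfull
  let adj := cornerAdjunction.{u, v, w} σ
  have hff : (coinducedFunctor.{u, v, w} σ).FullyFaithful := h.fullyFaithfulCoinduced
  have := hff.full
  have := hff.faithful
  -- As the right adjoint is fully faithful, the corner functor inverts the unit; being faithful on
  -- a balanced category, it reflects isomorphisms.
  have (M : ModuleCat.{max u w} R) : IsIso (adj.unit.app M) := by
    have : IsIso ((cornerFunctor.{u, v, max u w} σ).map (adj.unit.app M)) := inferInstance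
    exact isIso_of_reflects_iso _ (cornerFunctor.{u, v, max u w} σ)
  have : IsIso adj.unit := NatIso.isIso_of_isIso_app _
  exact adj.toEquivalence.isEquivalence_functor

end CornerFunctor

/-! ### Corner rings as algebras over the base field. -/

namespace IsIdempotentElem

variable {K A : Type*} [Field K] [Ring A] [Algebra K A] {d : A} (hd : IsIdempotentElem d)

instance cornerSMul : SMul K hd.Corner where
  smul c a := ⟨c • a.1, by
    have := (Subsemigroup.mem_corner_iff hd).1 a.2
    rw [Subsemigroup.mem_corner_iff hd, mul_smul_comm, smul_mul_assoc, this.1, this.2]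
    exact ⟨rfl, rfl⟩⟩

/-- The inclusion of a corner ring, as an additive map. -/
def cornerVal : hd.Corner →+ A where
  toFun a := a.1
  map_zero' := rfl
  map_add' _ _ := rfl

instance cornerModule : Module K hd.Corner :=
  Function.Injective.module K hd.cornerVal Subtype.val_injective fun _ _ => rfl

instance cornerAlgebra : Algebra K hd.Corner :=
  Algebra.ofModule (fun c a b => Subtype.ext (smul_mul_assoc c a.1 b.1))
    (fun c a b => Subtype.ext (mul_smul_comm c a.1 b.1))

/-- The inclusion of a corner ring, as a homomorphism of nonunital algebras. -/
def cornerSubtype : hd.Corner →ₙₐ[K] A where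
  toFun a := a.1
  map_zero' := rfl
  map_add' _ _ := rfl
  map_smul' _ _ := rfl
  map_mul' _ _ := rfl

end IsIdempotentElem

/-! ### Cuntz–Krieger families and their basic products. -/

namespace DirectedGraph

open scoped Classical

/-- A Cuntz–Krieger family in `A` for the subgraph of `E` spanned by the set `W` of vertices,
indexed by all the vertices and edges of `E` and extended by zero. -/
structure CKFamily (E : DirectedGraph.{u, v}) [Fintype E.Edge] (W : Set E.Vert) (A : Type*)
    [Ring A] where
  /-- the vertex projections -/
  P : E.Vert → A
  /-- the images of the edges -/
  S : E.Edge → A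
  /-- the images of the ghost edges -/
  T : E.Edge → A
  P_eq_zero : ∀ x, x ∉ W → P x = 0
  S_eq_zero : ∀ e, ¬ (E.src e ∈ W ∧ E.rng e ∈ W) → S e = 0
  T_eq_zero : ∀ e, ¬ (E.src e ∈ W ∧ E.rng e ∈ W) → T e = 0
  P_mul_self : ∀ x, P x * P x = P x
  P_mul_of_ne : ∀ x y, x ≠ y → P x * P y = 0
  P_mul_S : ∀ e, P (E.src e) * S e = S e
  S_mul_P : ∀ e, S e * P (E.rng e) = S e
  P_mul_T : ∀ e, P (E.rng e) * T e = T e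
  T_mul_P : ∀ e, T e * P (E.src e) = T e
  T_mul_S : ∀ e, E.src e ∈ W → E.rng e ∈ W → T e * S e = P (E.rng e)
  T_mul_S_of_ne : ∀ e f, e ≠ f → T e * S f = 0
  -- The hypotheses say that `x` is a vertex of the subgraph and not a sink there. Edges leaving `W`
  -- contribute zero to the sum.
  P_eq_sum : ∀ x, (∃ e, E.src e = x ∧ E.rng e ∈ W) → x ∈ W →
    P x = ∑ e, if E.src e = x then S e * T e else 0

namespace CKFamily

variable {E : DirectedGraph.{u, v}} [Fintype E.Edge] {W : Set E.Vert} {A : Type*}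
    [Ring A] (F : CKFamily E W A)

lemma P_mul_P (x y : E.Vert) : F.P x * F.P y = if x = y then F.P x else 0 := by
  split_ifs with h
  · rw [h, F.P_mul_self]
  · exact F.P_mul_of_ne x y h

lemma P_mul_S_eq_ite (x : E.Vert) (e : E.Edge) :
    F.P x * F.S e = if x = E.src e then F.S e else 0 := by
  rw [← F.P_mul_S e, ← mul_assoc, F.P_mul_P]
  split_ifs with h
  · rw [h]
  · rw [zero_mul]

lemma T_mul_P_eq_ite (e : E.Edge) (x : E.Vert) :
    F.T e * F.P x = if E.src e = x then F.T e else 0 := by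
  rw [← F.T_mul_P e, mul_assoc, F.P_mul_P]
  split_ifs with h
  · rfl
  · rw [mul_zero]

lemma T_mul_S_eq_ite (e f : E.Edge) (he : E.src e ∈ W) :
    F.T e * F.S f = if e = f then F.P (E.rng e) else 0 := by
  split_ifs with h
  · subst h
    by_cases hr : E.rng e ∈ W
    · exact F.T_mul_S e he hr
    · rw [F.S_eq_zero e (fun h => hr h.2), F.P_eq_zero _ hr, mul_zero]
  · exact F.T_mul_S_of_ne e f h

variable [Fintype E.Vert]

/-- The sum of the vertex projections. -/
def one : A := ∑ x, F.P x

lemma one_mul_P (x : E.Vert) : F.one * F.P x = F.P x := by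
  simp [one, Finset.sum_mul, F.P_mul_P]

lemma P_mul_one (x : E.Vert) : F.P x * F.one = F.P x := by
  simp [one, Finset.mul_sum, F.P_mul_P]

lemma isIdempotentElem_one : IsIdempotentElem F.one := by
  change F.one * F.one = F.one
  conv_lhs => rw [show F.one * F.one = F.one * ∑ x, F.P x from rfl, Finset.mul_sum]
  exact Finset.sum_congr rfl fun x _ => F.one_mul_P x

lemma one_mul_S (e : E.Edge) : F.one * F.S e = F.S e := by
  rw [← F.P_mul_S, ← mul_assoc, one_mul_P]

lemma S_mul_one (e : E.Edge) : F.S e * F.one = F.S e := by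
  rw [← F.S_mul_P, mul_assoc, P_mul_one]

lemma one_mul_T (e : E.Edge) : F.one * F.T e = F.T e := by
  rw [← F.P_mul_T, ← mul_assoc, one_mul_P]

lemma T_mul_one (e : E.Edge) : F.T e * F.one = F.T e := by
  rw [← F.T_mul_P, mul_assoc, P_mul_one]

end CKFamily

/-! ### The universal property of the Leavitt path algebra. -/

section Lift

lemma finsum_subtype_eq_sum_ite {α M : Type*} [Fintype α] [AddCommMonoid M] (p : α → Prop)
    (f : α → M) : ∑ᶠ a : {a // p a}, f a.1 = ∑ a, if p a then f a else 0 := by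
  rw [finsum_eq_sum_of_fintype, ← Finset.sum_filter]
  exact (Finset.sum_subtype (Finset.univ.filter p) (by simp) f).symm

variable {K : Type w} [Field K] {G : DirectedGraph.{u, v}}

section

variable {A : Type*} [Ring A] [Algebra K A] [Fintype G.Vert] [Fintype G.Edge]
    (F : CKFamily G Set.univ A)

/-- The images of the generators in the corner ring of a Cuntz–Krieger family. -/
noncomputable def CKFamily.generatorMap : Generator G → F.isIdempotentElem_one.Corner
  | .vert x => ⟨F.P x, (Subsemigroup.mem_corner_iff F.isIdempotentElem_one).2
      ⟨F.one_mul_P x, F.P_mul_one x⟩⟩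
  | .edge e => ⟨F.S e, (Subsemigroup.mem_corner_iff F.isIdempotentElem_one).2
      ⟨F.one_mul_S e, F.S_mul_one e⟩⟩
  | .ghost e => ⟨F.T e, (Subsemigroup.mem_corner_iff F.isIdempotentElem_one).2
      ⟨F.one_mul_T e, F.T_mul_one e⟩⟩

/-- The homomorphism from the free algebra to the corner ring of a Cuntz–Krieger family. -/
noncomputable def CKFamily.freeLift : FreeAlgebra K G.Generator →ₐ[K]
    F.isIdempotentElem_one.Corner :=
  FreeAlgebra.lift K F.generatorMap

lemma CKFamily.freeLift_vert (x : G.Vert) :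
    F.isIdempotentElem_one.cornerSubtype (K := K) (F.freeLift (vertElt K G x)) = F.P x := by
  rw [freeLift, vertElt, FreeAlgebra.lift_ι_apply]; rfl

lemma CKFamily.freeLift_edge (e : G.Edge) :
    F.isIdempotentElem_one.cornerSubtype (K := K) (F.freeLift (edgeElt K G e)) = F.S e := by
  rw [freeLift, edgeElt, FreeAlgebra.lift_ι_apply]; rfl

lemma CKFamily.freeLift_ghost (e : G.Edge) :
    F.isIdempotentElem_one.cornerSubtype (K := K) (F.freeLift (ghostElt K G e)) = F.T e := by
  rw [freeLift, ghostElt, FreeAlgebra.lift_ι_apply]; rfl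

lemma CKFamily.freeLift_rel {a b : FreeAlgebra K G.Generator} (h : LeavittRel K G a b) :
    F.freeLift a = F.freeLift b := by
  have hinj : Function.Injective (F.isIdempotentElem_one.cornerSubtype (K := K)) :=
    Subtype.val_injective
  apply hinj
  cases h with
  | vert_mul_self x => simp only [map_mul, freeLift_vert, F.P_mul_self]
  | vert_mul_of_ne x y h => simp only [map_mul, map_zero, freeLift_vert, F.P_mul_of_ne x y h]
  | src_mul_edge e => simp only [map_mul, freeLift_vert, freeLift_edge, F.P_mul_S]
  | edge_mul_rng e => simp only [map_mul, freeLift_vert, freeLift_edge, F.S_mul_P]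
  | rng_mul_ghost e => simp only [map_mul, freeLift_vert, freeLift_ghost, F.P_mul_T]
  | ghost_mul_src e => simp only [map_mul, freeLift_vert, freeLift_ghost, F.T_mul_P]
  | ghost_mul_self e =>
    simp only [map_mul, freeLift_vert, freeLift_ghost, freeLift_edge,
      F.T_mul_S e trivial trivial]
  | ghost_mul_of_ne e f h =>
    simp only [map_mul, map_zero, freeLift_ghost, freeLift_edge, F.T_mul_S_of_ne e f h]
  | vert_eq_sum x h =>
    rw [finsum_subtype_eq_sum_ite (fun e => G.src e = x)
      (fun e => edgeElt K G e * ghostElt K G e)]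
    have hx : ∃ e, G.src e = x ∧ G.rng e ∈ Set.univ := by
      simpa [IsSink] using h
    simp only [map_sum, apply_ite F.freeLift,
      apply_ite (F.isIdempotentElem_one.cornerSubtype (K := K)), map_mul, map_zero,
      freeLift_vert, freeLift_ghost, freeLift_edge, F.P_eq_sum x hx trivial]
  -- This relation is the reason for mapping into the corner: the vertex projections need not sum to
  -- 1 in `A`, but their sum is the unit of the corner.
  | sum_vert =>
    rw [finsum_eq_sum_of_fintype]
    simp only [map_sum, map_one, freeLift_vert]
    rfl

/-- The homomorphism from the Leavitt path algebra given by a Cuntz–Krieger family. -/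
noncomputable def CKFamily.lift : G.LeavittPathAlgebra K →ₙₐ[K] A :=
  (F.isIdempotentElem_one.cornerSubtype (K := K)).comp
    ((RingQuot.liftAlgHom K ⟨F.freeLift, fun _ _ h => F.freeLift_rel h⟩ :
      G.LeavittPathAlgebra K →ₐ[K] _) : G.LeavittPathAlgebra K →ₙₐ[K] _)

end

variable (K)

/-- A vertex in the Leavitt path algebra. -/
noncomputable def lVert [Finite G.Vert] [Finite G.Edge] (x : G.Vert) : G.LeavittPathAlgebra K :=
  RingQuot.mkAlgHom K (LeavittRel K G) (vertElt K G x)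

/-- An edge in the Leavitt path algebra. -/
noncomputable def lEdge [Finite G.Vert] [Finite G.Edge] (e : G.Edge) : G.LeavittPathAlgebra K :=
  RingQuot.mkAlgHom K (LeavittRel K G) (edgeElt K G e)

/-- A ghost edge in the Leavitt path algebra. -/
noncomputable def lGhost [Finite G.Vert] [Finite G.Edge] (e : G.Edge) : G.LeavittPathAlgebra K :=
  RingQuot.mkAlgHom K (LeavittRel K G) (ghostElt K G e)

variable {K}

@[elab_as_elim]
lemma leavitt_induction [Finite G.Vert] [Finite G.Edge] {p : G.LeavittPathAlgebra K → Prop}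
    (hK : ∀ c : K, p (algebraMap K _ c)) (hv : ∀ x, p (lVert K x)) (he : ∀ e, p (lEdge K e))
    (hg : ∀ e, p (lGhost K e)) (hadd : ∀ a b, p a → p b → p (a + b))
    (hmul : ∀ a b, p a → p b → p (a * b)) (a : G.LeavittPathAlgebra K) : p a := by
  obtain ⟨a, rfl⟩ := RingQuot.mkAlgHom_surjective K (LeavittRel K G) a
  induction a using FreeAlgebra.induction with
  | grade0 c => rw [AlgHom.commutes]; exact hK c
  | grade1 x =>
    cases x with
    | vert x => exact hv x
    | edge e => exact he e
    | ghost e => exact hg e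
  | mul a b ha hb => rw [map_mul]; exact hmul _ _ ha hb
  | add a b ha hb => rw [map_add]; exact hadd _ _ ha hb

section

variable {A : Type*} [Ring A] [Algebra K A] [Fintype G.Vert] [Fintype G.Edge]
    (F : CKFamily G Set.univ A)

lemma CKFamily.lift_mk (a : FreeAlgebra K G.Generator) :
    F.lift (RingQuot.mkAlgHom K (LeavittRel K G) a) =
      F.isIdempotentElem_one.cornerSubtype (K := K) (F.freeLift a) := by
  change F.isIdempotentElem_one.cornerSubtype (K := K) (RingQuot.liftAlgHom K _ _) = _
  rw [RingQuot.liftAlgHom_mkAlgHom_apply]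

@[simp]
lemma CKFamily.lift_vert (x : G.Vert) : F.lift (lVert K x) = F.P x := by
  rw [lVert, lift_mk, freeLift_vert]

@[simp]
lemma CKFamily.lift_edge (e : G.Edge) : F.lift (lEdge K e) = F.S e := by
  rw [lEdge, lift_mk, freeLift_edge]

@[simp]
lemma CKFamily.lift_ghost (e : G.Edge) : F.lift (lGhost K e) = F.T e := by
  rw [lGhost, lift_mk, freeLift_ghost]

@[simp]
lemma CKFamily.lift_one : F.lift (1 : G.LeavittPathAlgebra K) = F.one := by
  rw [← map_one (RingQuot.mkAlgHom K (LeavittRel K G)), lift_mk, map_one]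
  rfl

variable (K G) in
/-- The vertices, edges and ghost edges of a Leavitt path algebra form a Cuntz–Krieger family. -/
noncomputable def leavittFamily : CKFamily G Set.univ (G.LeavittPathAlgebra K) where
  P := lVert K
  S := lEdge K
  T := lGhost K
  P_eq_zero x hx := (hx trivial).elim
  S_eq_zero e he := (he ⟨trivial, trivial⟩).elim
  T_eq_zero e he := (he ⟨trivial, trivial⟩).elim
  P_mul_self x := by
    rw [lVert, ← map_mul, RingQuot.mkAlgHom_rel K (.vert_mul_self x)]
  P_mul_of_ne x y h := by
    rw [lVert, lVert, ← map_mul, RingQuot.mkAlgHom_rel K (.vert_mul_of_ne x y h), map_zero]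
  P_mul_S e := by
    rw [lVert, lEdge, ← map_mul, RingQuot.mkAlgHom_rel K (.src_mul_edge e)]
  S_mul_P e := by
    rw [lVert, lEdge, ← map_mul, RingQuot.mkAlgHom_rel K (.edge_mul_rng e)]
  P_mul_T e := by
    rw [lVert, lGhost, ← map_mul, RingQuot.mkAlgHom_rel K (.rng_mul_ghost e)]
  T_mul_P e := by
    rw [lVert, lGhost, ← map_mul, RingQuot.mkAlgHom_rel K (.ghost_mul_src e)]
  T_mul_S e _ _ := by
    rw [lVert, lGhost, lEdge, ← map_mul, RingQuot.mkAlgHom_rel K (.ghost_mul_self e)]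
  T_mul_S_of_ne e f h := by
    rw [lGhost, lEdge, ← map_mul, RingQuot.mkAlgHom_rel K (.ghost_mul_of_ne e f h), map_zero]
  P_eq_sum x hx _ := by
    have h : ¬ G.IsSink x := by
      obtain ⟨e, he, -⟩ := hx
      exact fun h => h e he
    rw [lVert, RingQuot.mkAlgHom_rel K (.vert_eq_sum x h),
      finsum_subtype_eq_sum_ite (fun e => G.src e = x)
      (fun e => edgeElt K G e * ghostElt K G e), map_sum]
    simp only [apply_ite (RingQuot.mkAlgHom K (LeavittRel K G)), map_mul, map_zero]
    rfl

lemma one_leavittFamily : (leavittFamily K G).one = 1 := by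
  rw [← map_one (RingQuot.mkAlgHom K (LeavittRel K G)),
    ← RingQuot.mkAlgHom_rel K LeavittRel.sum_vert, finsum_eq_sum_of_fintype, map_sum]
  rfl

end

end Lift

/-! ### Families on an induced subgraph, indexed by the subgraph or by all of E. -/

section Induce

variable {E : DirectedGraph.{u, v}} [Fintype E.Edge] {W : Set E.Vert}
  [Fintype (E.induce W).Edge] {A : Type*} [Ring A]

/-- A sum over the edges of an induced subgraph, as a sum over all edges. -/
lemma sum_induce_edge {M : Type*} [AddCommMonoid M] (f : E.Edge → M)
    (hf : ∀ e, ¬ (E.src e ∈ W ∧ E.rng e ∈ W) → f e = 0) :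
    ∑ e : (E.induce W).Edge, f e.1 = ∑ e, f e := by
  have : ∑ e : (E.induce W).Edge, f e.1 = ∑ᶠ e : {e // E.src e ∈ W ∧ E.rng e ∈ W}, f e.1 :=
    (finsum_eq_sum_of_fintype _).symm
  rw [this, finsum_subtype_eq_sum_ite (fun e => E.src e ∈ W ∧ E.rng e ∈ W) f]
  refine Finset.sum_congr rfl fun e _ => ?_
  split_ifs with h
  · rfl
  · exact (hf e h).symm

/-- A sum over the vertices of an induced subgraph, as a sum over all vertices. -/
lemma sum_induce_vert {E : DirectedGraph.{u, v}} {W : Set E.Vert} [Fintype E.Vert]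
    [Fintype (E.induce W).Vert] {M : Type*} [AddCommMonoid M]
    (f : E.Vert → M) (hf : ∀ x, x ∉ W → f x = 0) :
    ∑ x : (E.induce W).Vert, f x.1 = ∑ x, f x := by
  have : ∑ x : (E.induce W).Vert, f x.1 = ∑ᶠ x : {x // x ∈ W}, f x.1 :=
    (finsum_eq_sum_of_fintype _).symm
  rw [this, finsum_subtype_eq_sum_ite (fun x => x ∈ W) f]
  refine Finset.sum_congr rfl fun x _ => ?_
  split_ifs with h
  · rfl
  · exact (hf x h).symm

/-- A family for the subgraph spanned by `W`, indexed by the vertices and edges of the subgraph. -/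
def CKFamily.restrict (F : CKFamily E W A) : CKFamily (E.induce W) Set.univ A where
  P x := F.P x.1
  S e := F.S e.1
  T e := F.T e.1
  P_eq_zero x hx := (hx trivial).elim
  S_eq_zero e he := (he ⟨trivial, trivial⟩).elim
  T_eq_zero e he := (he ⟨trivial, trivial⟩).elim
  P_mul_self x := F.P_mul_self x.1
  P_mul_of_ne x y h := F.P_mul_of_ne x.1 y.1 fun h' => h (Subtype.ext h')
  P_mul_S e := F.P_mul_S e.1
  S_mul_P e := F.S_mul_P e.1
  P_mul_T e := F.P_mul_T e.1
  T_mul_P e := F.T_mul_P e.1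
  T_mul_S e _ _ := F.T_mul_S e.1 e.2.1 e.2.2
  T_mul_S_of_ne e f h := F.T_mul_S_of_ne e.1 f.1 fun h' => h (Subtype.ext h')
  P_eq_sum x hx _ := by
    obtain ⟨e, he, -⟩ := hx
    rw [F.P_eq_sum x.1 ⟨e.1, congrArg Subtype.val he, e.2.2⟩ x.2,
      ← sum_induce_edge (W := W)]
    · refine Finset.sum_congr rfl fun e _ => if_congr ?_ rfl rfl
      exact ⟨fun h => Subtype.ext h, fun h => congrArg Subtype.val h⟩
    · intro e he
      rw [F.S_eq_zero e he, zero_mul, ite_self]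

/-- A family for an induced subgraph, extended by zero. -/
noncomputable def CKFamily.extend (F : CKFamily (E.induce W) Set.univ A) : CKFamily E W A where
  P x := if h : x ∈ W then F.P ⟨x, h⟩ else 0
  S e := if h : E.src e ∈ W ∧ E.rng e ∈ W then F.S ⟨e, h⟩ else 0
  T e := if h : E.src e ∈ W ∧ E.rng e ∈ W then F.T ⟨e, h⟩ else 0
  P_eq_zero x hx := dif_neg hx
  S_eq_zero e he := dif_neg he
  T_eq_zero e he := dif_neg he
  P_mul_self x := by
    split_ifs with h
    · exact F.P_mul_self _
    · exact zero_mul _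
  P_mul_of_ne x y hxy := by
    split_ifs with h h'
    · exact F.P_mul_of_ne _ _ fun h => hxy (congrArg Subtype.val h)
    all_goals simp
  P_mul_S e := by
    by_cases h : E.src e ∈ W ∧ E.rng e ∈ W
    · rw [dif_pos h, dif_pos h.1]; exact F.P_mul_S ⟨e, h⟩
    · rw [dif_neg h, mul_zero]
  S_mul_P e := by
    by_cases h : E.src e ∈ W ∧ E.rng e ∈ W
    · rw [dif_pos h, dif_pos h.2]; exact F.S_mul_P ⟨e, h⟩
    · rw [dif_neg h, zero_mul]
  P_mul_T e := by
    by_cases h : E.src e ∈ W ∧ E.rng e ∈ W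
    · rw [dif_pos h, dif_pos h.2]; exact F.P_mul_T ⟨e, h⟩
    · rw [dif_neg h, mul_zero]
  T_mul_P e := by
    by_cases h : E.src e ∈ W ∧ E.rng e ∈ W
    · rw [dif_pos h, dif_pos h.1]; exact F.T_mul_P ⟨e, h⟩
    · rw [dif_neg h, zero_mul]
  T_mul_S e h h' := by
    rw [dif_pos ⟨h, h'⟩, dif_pos ⟨h, h'⟩, dif_pos h']
    exact F.T_mul_S ⟨e, h, h'⟩ trivial trivial
  T_mul_S_of_ne e f hef := by
    split_ifs with h h'
    · exact F.T_mul_S_of_ne _ _ fun h => hef (congrArg Subtype.val h)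
    all_goals simp
  P_eq_sum x hx hxW := by
    obtain ⟨e, rfl, he⟩ := hx
    rw [dif_pos hxW, F.P_eq_sum ⟨E.src e, hxW⟩ ⟨⟨e, hxW, he⟩, rfl, trivial⟩ trivial,
      ← sum_induce_edge (W := W)]
    · refine Finset.sum_congr rfl fun e _ => ?_
      rw [dif_pos e.2, dif_pos e.2]
      exact if_congr Subtype.ext_iff rfl rfl
    · intro e he
      rw [dif_neg he, zero_mul, ite_self]

lemma CKFamily.one_restrict [Fintype E.Vert] [Fintype (E.induce W).Vert] (F : CKFamily E W A) :
    F.restrict.one = F.one :=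
  sum_induce_vert F.P F.P_eq_zero

lemma CKFamily.extend_P (F : CKFamily (E.induce W) Set.univ A) (x : (E.induce W).Vert) :
    F.extend.P x.1 = F.P x := dif_pos x.2

lemma CKFamily.extend_S (F : CKFamily (E.induce W) Set.univ A) (e : (E.induce W).Edge) :
    F.extend.S e.1 = F.S e := dif_pos e.2

lemma CKFamily.extend_T (F : CKFamily (E.induce W) Set.univ A) (e : (E.induce W).Edge) :
    F.extend.T e.1 = F.T e := dif_pos e.2

lemma CKFamily.one_extend [Fintype E.Vert] [Fintype (E.induce W).Vert]
    (F : CKFamily (E.induce W) Set.univ A) : F.extend.one = F.one :=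
  (sum_induce_vert F.extend.P F.extend.P_eq_zero).symm.trans
    (Finset.sum_congr rfl fun x _ => F.extend_P x)

end Induce

/-! ### New families from old: restriction, enlargement, matrices. -/

variable {K : Type w} [Field K] {E : DirectedGraph.{u, v}} [Fintype E.Edge] {W V : Set E.Vert}

/-- Every vertex of `W` emits an edge into `W`. -/
def NoSinks (W : Set E.Vert) : Prop := ∀ x ∈ W, ∃ e, E.src e = x ∧ E.rng e ∈ W

namespace CKFamily

section

variable {A : Type*} [Ring A] (F : CKFamily E W A)

/-- Sum the relation P_x = ∑ S_e T_e over all x. It holds at every vertex since `W` has no sinks,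
and both sides vanish outside `W`. -/
lemma sum_S_mul_T [Fintype E.Vert] (hW : NoSinks W) : ∑ e, F.S e * F.T e = F.one := by
  have h (x : E.Vert) : F.P x = ∑ e, if E.src e = x then F.S e * F.T e else 0 := by
    by_cases hx : x ∈ W
    · exact F.P_eq_sum x (hW x hx) hx
    · rw [F.P_eq_zero x hx]
      refine (Finset.sum_eq_zero fun e _ => ?_).symm
      split_ifs with he
      · rw [F.S_eq_zero e (fun h => hx (he ▸ h.1)), zero_mul]
      · rfl
  rw [one, Finset.sum_congr rfl fun x _ => h x, Finset.sum_comm]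
  simp

/-- The restriction of a family to a set `V` of vertices of `W` that contains the range of every
edge of `W`. -/
noncomputable def cut (hVW : V ⊆ W) (hV : ∀ e, E.src e ∈ W → E.rng e ∈ W → E.rng e ∈ V) :
    CKFamily E V A where
  P x := if x ∈ V then F.P x else 0
  S e := if E.src e ∈ V then F.S e else 0
  T e := if E.src e ∈ V then F.T e else 0
  P_eq_zero x hx := if_neg hx
  S_eq_zero e he := by
    split_ifs with h
    · exact F.S_eq_zero e fun h' => he ⟨h, hV e h'.1 h'.2⟩
    · rfl
  T_eq_zero e he := by
    split_ifs with h
    · exact F.T_eq_zero e fun h' => he ⟨h, hV e h'.1 h'.2⟩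
    · rfl
  P_mul_self x := by
    split_ifs
    · exact F.P_mul_self x
    · exact zero_mul _
  P_mul_of_ne x y h := by
    split_ifs
    · exact F.P_mul_of_ne x y h
    all_goals simp
  P_mul_S e := by
    split_ifs
    · exact F.P_mul_S e
    · exact zero_mul _
  S_mul_P e := by
    by_cases h : E.src e ∈ V ∧ E.rng e ∈ V
    · rw [if_pos h.1, if_pos h.2, F.S_mul_P]
    · have : (if E.src e ∈ V then F.S e else 0) = 0 := by
        split_ifs with h1
        · exact F.S_eq_zero e fun h' => h ⟨h1, hV e h'.1 h'.2⟩
        · rfl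
      rw [this, zero_mul]
  P_mul_T e := by
    by_cases h : E.src e ∈ V ∧ E.rng e ∈ V
    · rw [if_pos h.1, if_pos h.2, F.P_mul_T]
    · have : (if E.src e ∈ V then F.T e else 0) = 0 := by
        split_ifs with h1
        · exact F.T_eq_zero e fun h' => h ⟨h1, hV e h'.1 h'.2⟩
        · rfl
      rw [this, mul_zero]
  T_mul_P e := by
    split_ifs
    · exact F.T_mul_P e
    · exact zero_mul _
  T_mul_S e h h' := by
    rw [if_pos h, if_pos h, if_pos h', F.T_mul_S e (hVW h) (hVW h')]
  T_mul_S_of_ne e f h := by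
    split_ifs
    · exact F.T_mul_S_of_ne e f h
    all_goals simp
  P_eq_sum x hx hxV := by
    obtain ⟨e, he, heV⟩ := hx
    -- No edge is lost: an edge of `W` that starts in `V` also ends in `V`, so both subgraphs give
    -- the same sum at `x`.
    rw [if_pos hxV, F.P_eq_sum x ⟨e, he, hVW heV⟩ (hVW hxV)]
    refine Finset.sum_congr rfl fun f _ => ?_
    split_ifs with h h'
    · rfl
    · exact (h' (h ▸ hxV)).elim
    · rfl

/-- A family for the full graph, from a family for a set of vertices which is closed under
predecessors and whose vertices emit edges into the set. -/
noncomputable def enlarge (hW : NoSinks W) (hpred : ∀ e, E.rng e ∈ W → E.src e ∈ W) :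
    CKFamily E Set.univ A where
  P := F.P
  S := F.S
  T := F.T
  P_eq_zero x hx := (hx trivial).elim
  S_eq_zero e he := (he ⟨trivial, trivial⟩).elim
  T_eq_zero e he := (he ⟨trivial, trivial⟩).elim
  P_mul_self := F.P_mul_self
  P_mul_of_ne := F.P_mul_of_ne
  P_mul_S := F.P_mul_S
  S_mul_P := F.S_mul_P
  P_mul_T := F.P_mul_T
  T_mul_P := F.T_mul_P
  T_mul_S e _ _ := by
    by_cases h : E.rng e ∈ W
    · exact F.T_mul_S e (hpred e h) h
    · rw [F.P_eq_zero _ h, F.S_eq_zero e (fun h' => h h'.2), mul_zero]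
  T_mul_S_of_ne := F.T_mul_S_of_ne
  -- A vertex outside `W` may emit edges of E, but their operators are zero, as is its projection.
  P_eq_sum x _ _ := by
    by_cases hx : x ∈ W
    · exact F.P_eq_sum x (hW x hx) hx
    · rw [F.P_eq_zero x hx]
      refine (Finset.sum_eq_zero fun e _ => ?_).symm
      split_ifs with he
      · rw [F.S_eq_zero e (fun h => hx (he ▸ h.1)), zero_mul]
      · rfl

/-- A family for a set of vertices `W` without sinks, in matrices over an algebra with a family
for a subset `V` that contains the range of every edge of `W`. -/
noncomputable def matrixFamily (hW : NoSinks W) (F : CKFamily E V A) (hVW : V ⊆ W)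
    (hV : ∀ e, E.src e ∈ W → E.rng e ∈ W → E.rng e ∈ V) :
    CKFamily E W (Matrix E.Edge E.Edge A) where
  -- The entries are the values of T_e a S_{e'} computed with the relations for `W`: T_e P_x S_{e'}
  -- is P_{r(e)} if e = e' starts at x, T_e S_g S_{e'} is S_{e'} if e = g and s(e') = r(g), and
  -- dually for T_g.
  P x := Matrix.of fun e e' => if e = e' ∧ E.src e = x ∧ E.src e ∈ W then F.P (E.rng e) else 0
  S g := Matrix.of fun e e' =>
    if e = g ∧ E.src e' = E.rng g ∧ E.src g ∈ W then F.S e' else 0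
  T g := Matrix.of fun e e' =>
    if e' = g ∧ E.src e = E.rng g ∧ E.src g ∈ W then F.T e else 0
  P_eq_zero x hx := by
    ext e e'
    simp only [Matrix.of_apply, Matrix.zero_apply]
    split_ifs with h
    · exact (hx (h.2.1 ▸ h.2.2)).elim
    · rfl
  S_eq_zero g hg := by
    ext e e'
    simp only [Matrix.of_apply, Matrix.zero_apply]
    split_ifs with h
    · exact F.S_eq_zero _ fun h' => hg ⟨h.2.2, h.2.1 ▸ hVW h'.1⟩
    · rfl
  T_eq_zero g hg := by
    ext e e'
    simp only [Matrix.of_apply, Matrix.zero_apply]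
    split_ifs with h
    · exact F.T_eq_zero _ fun h' => hg ⟨h.2.2, h.2.1 ▸ hVW h'.1⟩
    · rfl
  P_mul_self x := by
    ext e e'
    simp only [Matrix.mul_apply, Matrix.of_apply]
    rw [Finset.sum_eq_single e]
    · by_cases h1 : E.src e = x ∧ E.src e ∈ W
      · obtain ⟨rfl, h1⟩ := h1
        simp [h1, F.P_mul_self]
      · simp [h1]
    · intro f _ hf
      simp [hf.symm]
    · simp
  P_mul_of_ne x y hxy := by
    ext e e'
    simp only [Matrix.mul_apply, Matrix.of_apply, Matrix.zero_apply]
    refine Finset.sum_eq_zero fun f _ => ?_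
    split_ifs with h h'
    · exact (hxy (by rw [← h.2.1, h.1, h'.2.1])).elim
    all_goals simp
  P_mul_S g := by
    ext e e'
    simp only [Matrix.mul_apply, Matrix.of_apply]
    rw [Finset.sum_eq_single e]
    · by_cases h1 : e = g ∧ E.src e' = E.rng g ∧ E.src g ∈ W
      · obtain ⟨rfl, h2, h3⟩ := h1
        have h4 := F.P_mul_S e'
        rw [h2] at h4
        simp [h2, h3, h4]
      · simp [h1]
    · intro f _ hf
      simp [hf.symm]
    · simp
  S_mul_P g := by
    ext e e'
    simp only [Matrix.mul_apply, Matrix.of_apply]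
    rw [Finset.sum_eq_single e']
    · by_cases h1 : e = g ∧ E.src e' = E.rng g ∧ E.src g ∈ W
      · obtain ⟨rfl, h2, h3⟩ := h1
        by_cases h4 : E.rng e ∈ W
        · simp [h2, h3, h4, F.S_mul_P]
        · rw [F.S_eq_zero e' fun h => h4 (h2 ▸ hVW h.1)]
          simp
      · simp [h1]
    · intro f _ hf
      simp [hf]
    · simp
  P_mul_T g := by
    ext e e'
    simp only [Matrix.mul_apply, Matrix.of_apply]
    rw [Finset.sum_eq_single e]
    · by_cases h1 : e' = g ∧ E.src e = E.rng g ∧ E.src g ∈ W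
      · obtain ⟨rfl, h2, h3⟩ := h1
        by_cases h4 : E.rng e' ∈ W
        · simp [h2, h3, h4, F.P_mul_T]
        · rw [F.T_eq_zero e fun h => h4 (h2 ▸ hVW h.1)]
          simp
      · simp [h1]
    · intro f _ hf
      simp [hf.symm]
    · simp
  T_mul_P g := by
    ext e e'
    simp only [Matrix.mul_apply, Matrix.of_apply]
    rw [Finset.sum_eq_single e']
    · by_cases h1 : e' = g ∧ E.src e = E.rng g ∧ E.src g ∈ W
      · obtain ⟨rfl, h2, h3⟩ := h1
        have h4 := F.T_mul_P e
        rw [h2] at h4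
        simp [h2, h3, h4]
      · simp [h1]
    · intro f _ hf
      simp [hf]
    · simp
  T_mul_S g hg hg' := by
    ext e e'
    simp only [Matrix.mul_apply, Matrix.of_apply]
    rw [Finset.sum_eq_single g]
    · by_cases h1 : E.src e = E.rng g
      · by_cases h2 : E.src e' = E.rng g
        · have h3 : E.src e ∈ V := h1 ▸ hV g hg hg'
          have h4 : E.rng g ∈ W := hg'
          simp [h1, h2, hg, h4, F.T_mul_S_eq_ite e e' h3]
        · have : e ≠ e' := fun h => h2 (h ▸ h1)
          simp [h2, this]
      · simp [h1]
    · intro f _ hf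
      simp [hf]
    · simp
  T_mul_S_of_ne g g' h := by
    ext e e'
    simp only [Matrix.mul_apply, Matrix.of_apply, Matrix.zero_apply]
    refine Finset.sum_eq_zero fun f _ => ?_
    split_ifs with h1 h2
    · exact (h (h1.1.symm.trans h2.1)).elim
    all_goals simp
  P_eq_sum x _ hx := by
    ext e e'
    simp only [Matrix.sum_apply, Matrix.of_apply]
    rw [Finset.sum_eq_single e]
    · by_cases h1 : E.src e = x
      · have hx' : E.src e ∈ W := h1 ▸ hx
        by_cases h2 : e = e'
        · subst h2
          simp only [h1, hx, Matrix.mul_apply, Matrix.of_apply, true_and, and_true, if_true]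
          by_cases h3 : E.rng e ∈ V
          -- The diagonal entry at `e` is the vertex relation in `V` at r(e). It is available
          -- because r(e) emits an edge inside `W`, which then ends in `V`.
          · obtain ⟨f, hf, hf'⟩ := hW _ (hVW h3)
            rw [F.P_eq_sum _ ⟨f, hf, hV f (hf ▸ hVW h3) hf'⟩ h3]
            refine Finset.sum_congr rfl fun f _ => ?_
            split_ifs <;> simp
          · rw [F.P_eq_zero _ h3]
            refine (Finset.sum_eq_zero fun f _ => ?_).symm
            split_ifs with h
            · rw [F.S_eq_zero f fun h' => h3 (h ▸ h'.1), zero_mul]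
            · exact zero_mul _
        · simp [h1, h2, Matrix.mul_apply, Ne.symm h2]
      · simp [h1]
    · intro f _ hf
      split_ifs
      · simp [Matrix.mul_apply, hf.symm]
      · rfl
    · simp

end

end CKFamily

/-! ### The algebra of an induced subgraph, with generators indexed by E. -/

section SubFamily

variable (K : Type w) [Field K] {E : DirectedGraph.{u, v}} [Fintype E.Vert] [Fintype E.Edge]

noncomputable instance fintypeVertInduce (W : Set E.Vert) : Fintype (E.induce W).Vert :=
  Fintype.ofFinite _

noncomputable instance fintypeEdgeInduce (W : Set E.Vert) : Fintype (E.induce W).Edge :=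
  Fintype.ofFinite _

/-- The family of the generators of the Leavitt path algebra of an induced subgraph. -/
noncomputable def subFamily (W : Set E.Vert) :
    CKFamily E W ((E.induce W).LeavittPathAlgebra K) :=
  (leavittFamily K (E.induce W)).extend

lemma one_subFamily (W : Set E.Vert) : (subFamily K W).one = 1 := by
  rw [subFamily, CKFamily.one_extend, one_leavittFamily]

variable {K} {W : Set E.Vert}

-- Scalars enter only through multiples c • a, as 1 is a sum of vertex projections. This makes the
-- principle usable with homomorphisms that do not preserve 1.
@[elab_as_elim]
lemma subFamily_induction {p : (E.induce W).LeavittPathAlgebra K → Prop}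
    (hzero : p 0) (hsmul : ∀ (c : K) a, p a → p (c • a)) (hP : ∀ x, p ((subFamily K W).P x))
    (hS : ∀ e, p ((subFamily K W).S e)) (hT : ∀ e, p ((subFamily K W).T e))
    (hadd : ∀ a b, p a → p b → p (a + b))
    (hmul : ∀ a b, p a → p b → p (a * b)) (a : (E.induce W).LeavittPathAlgebra K) : p a := by
  induction a using leavitt_induction with
  | hK c =>
    rw [Algebra.algebraMap_eq_smul_one, ← one_subFamily]
    exact hsmul c _ (Finset.sum_induction _ p hadd hzero fun x _ => hP x)
  | hv x =>
    have := hP x.1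
    rwa [subFamily, CKFamily.extend_P] at this
  | he e =>
    have := hS e.1
    rwa [subFamily, CKFamily.extend_S] at this
  | hg e =>
    have := hT e.1
    rwa [subFamily, CKFamily.extend_T] at this
  | hadd a b ha hb => exact hadd a b ha hb
  | hmul a b ha hb => exact hmul a b ha hb

namespace CKFamily

variable {A : Type*} [Ring A] [Algebra K A] (F : CKFamily E W A)

/-- The homomorphism from the Leavitt path algebra of an induced subgraph given by a family. -/
noncomputable def subLift : (E.induce W).LeavittPathAlgebra K →ₙₐ[K] A := F.restrict.lift

lemma subLift_P (x : E.Vert) : F.subLift ((subFamily K W).P x) = F.P x := by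
  by_cases h : x ∈ W
  · rw [subFamily, CKFamily.extend_P _ ⟨x, h⟩]
    exact F.restrict.lift_vert ⟨x, h⟩
  · rw [CKFamily.P_eq_zero _ _ h, F.P_eq_zero _ h, map_zero]

lemma subLift_S (e : E.Edge) : F.subLift ((subFamily K W).S e) = F.S e := by
  by_cases h : E.src e ∈ W ∧ E.rng e ∈ W
  · rw [subFamily, CKFamily.extend_S _ ⟨e, h⟩]
    exact F.restrict.lift_edge ⟨e, h⟩
  · rw [CKFamily.S_eq_zero _ _ h, F.S_eq_zero _ h, map_zero]

lemma subLift_T (e : E.Edge) : F.subLift ((subFamily K W).T e) = F.T e := by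
  by_cases h : E.src e ∈ W ∧ E.rng e ∈ W
  · rw [subFamily, CKFamily.extend_T _ ⟨e, h⟩]
    exact F.restrict.lift_ghost ⟨e, h⟩
  · rw [CKFamily.T_eq_zero _ _ h, F.T_eq_zero _ h, map_zero]

lemma subLift_one : F.subLift (1 : (E.induce W).LeavittPathAlgebra K) = F.one := by
  rw [subLift, lift_one, one_restrict]

end CKFamily

end SubFamily

/-! ### Morita invariance under removal of sources. -/

section SourceRemoval

variable {K : Type w} [Field K] {E : DirectedGraph.{u, v}} [Fintype E.Vert] [Fintype E.Edge]
  {W V : Set E.Vert} (hW : NoSinks W) (hVW : V ⊆ W)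
  (hV : ∀ e, E.src e ∈ W → E.rng e ∈ W → E.rng e ∈ V)

omit [Fintype E.Vert] [Fintype E.Edge] in
lemma NoSinks.of_subset (hW : NoSinks W) (hVW : V ⊆ W)
    (hV : ∀ e, E.src e ∈ W → E.rng e ∈ W → E.rng e ∈ V) : NoSinks V := fun x hx => by
  obtain ⟨e, rfl, he⟩ := hW x (hVW hx)
  exact ⟨e, rfl, hV e (hVW hx) he⟩

variable (K) in
/-- The embedding of the Leavitt path algebra of the subgraph spanned by `V` in that of the
subgraph spanned by `W`. -/
noncomputable def cutHom :
    (E.induce V).LeavittPathAlgebra K →ₙₐ[K] (E.induce W).LeavittPathAlgebra K :=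
  ((subFamily K W).cut hVW hV).subLift

variable (K) in
/-- The homomorphism from the Leavitt path algebra of the subgraph spanned by `W` to matrices over
that of the subgraph spanned by `V`. -/
noncomputable def matrixHom :
    (E.induce W).LeavittPathAlgebra K →ₙₐ[K]
      Matrix E.Edge E.Edge ((E.induce V).LeavittPathAlgebra K) :=
  (CKFamily.matrixFamily hW (subFamily K V) hVW hV).subLift

omit [Fintype E.Vert] in
lemma CKFamily.T_mul_S_eq_ite' {A : Type*} [Ring A] (F : CKFamily E W A) (e f : E.Edge) :
    F.T e * F.S f = if e = f ∧ E.src e ∈ W then F.P (E.rng e) else 0 := by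
  by_cases he : E.src e ∈ W
  · rw [F.T_mul_S_eq_ite e f he]
    simp [he]
  · rw [F.T_eq_zero e fun h => he h.1]
    simp [he]

lemma cutHom_P (x : E.Vert) :
    cutHom K hVW hV ((subFamily K V).P x) = if x ∈ V then (subFamily K W).P x else 0 :=
  CKFamily.subLift_P _ x

lemma cutHom_S (e : E.Edge) :
    cutHom K hVW hV ((subFamily K V).S e) = if E.src e ∈ V then (subFamily K W).S e else 0 :=
  CKFamily.subLift_S _ e

lemma cutHom_T (e : E.Edge) :
    cutHom K hVW hV ((subFamily K V).T e) = if E.src e ∈ V then (subFamily K W).T e else 0 :=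
  CKFamily.subLift_T _ e

lemma matrixHom_P (x : E.Vert) (e e' : E.Edge) :
    matrixHom K hW hVW hV ((subFamily K W).P x) e e' =
      if e = e' ∧ E.src e = x ∧ E.src e ∈ W then (subFamily K V).P (E.rng e) else 0 := by
  rw [matrixHom, CKFamily.subLift_P]; rfl

lemma matrixHom_S (g : E.Edge) (e e' : E.Edge) :
    matrixHom K hW hVW hV ((subFamily K W).S g) e e' =
      if e = g ∧ E.src e' = E.rng g ∧ E.src g ∈ W then (subFamily K V).S e' else 0 := by
  rw [matrixHom, CKFamily.subLift_S]; rfl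

lemma matrixHom_T (g : E.Edge) (e e' : E.Edge) :
    matrixHom K hW hVW hV ((subFamily K W).T g) e e' =
      if e' = g ∧ E.src e = E.rng g ∧ E.src g ∈ W then (subFamily K V).T e else 0 := by
  rw [matrixHom, CKFamily.subLift_T]; rfl

lemma sum_subFamily_S_mul_T (hW : NoSinks W) :
    ∑ e, (subFamily K W).S e * (subFamily K W).T e = 1 := by
  rw [CKFamily.sum_S_mul_T _ hW, one_subFamily]

/-- Inserting 1 = ∑ S_e T_e between two factors is what makes a ↦ (T_e a S_{e'}) multiplicative for
matrices. -/
lemma mul_eq_sum_mul_S_mul_T_mul (hW : NoSinks W) (a b : (E.induce W).LeavittPathAlgebra K) :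
    a * b = ∑ e, a * (subFamily K W).S e * ((subFamily K W).T e * b) := by
  calc a * b = a * (1 * b) := by rw [one_mul]
    _ = _ := by
      rw [← sum_subFamily_S_mul_T hW, Finset.sum_mul, Finset.mul_sum]
      simp only [mul_assoc]

/-- Both sides are multiplicative as matrices in (e, e'), so comparing them on generators suffices.
Thus every T_e a S_{e'} comes from the smaller algebra. -/
lemma cutHom_matrixHom_apply (a : (E.induce W).LeavittPathAlgebra K) (e e' : E.Edge) :
    cutHom K hVW hV (matrixHom K hW hVW hV a e e') =
      (subFamily K W).T e * a * (subFamily K W).S e' := by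
  -- For an edge that starts in `W`, ending outside `V` means ending outside `W`; there both sides
  -- vanish.
  have hr (e : E.Edge) (he : E.src e ∈ W) (h : E.rng e ∉ V) : E.rng e ∉ W :=
    fun h' => h (hV e he h')
  induction a using subFamily_induction generalizing e e' with
  | hzero => simp
  | hsmul c a ha => simp [map_smul, Matrix.smul_apply, ha]
  | hP x =>
    rw [matrixHom_P, CKFamily.T_mul_P_eq_ite, apply_ite (cutHom K hVW hV), cutHom_P, map_zero,
      ite_mul, CKFamily.T_mul_S_eq_ite', zero_mul]
    by_cases h1 : E.src e ∈ W
    · by_cases h2 : E.rng e ∈ V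
      · by_cases h3 : e = e'
        · subst h3
          by_cases h4 : E.src e = x
          · subst h4
            simp [h1, h2]
          · simp [h4]
        · simp [h3]
      · simp [h2, (subFamily K W).P_eq_zero _ (hr e h1 h2)]
    · simp [h1]
  | hS g =>
    rw [matrixHom_S, CKFamily.T_mul_S_eq_ite', apply_ite (cutHom K hVW hV), cutHom_S, map_zero,
      ite_mul, CKFamily.P_mul_S_eq_ite, zero_mul]
    by_cases h1 : e = g
    · subst h1
      by_cases h2 : E.src e ∈ W
      · by_cases h3 : E.src e' = E.rng e
        · by_cases h4 : E.rng e ∈ V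
          · simp [h2, h3, h4]
          · simp [h4, h3, (subFamily K W).S_eq_zero e' fun h => hr e h2 h4 (h3 ▸ h.1)]
        · simp [h3, Ne.symm h3]
      · simp [h2]
    · simp [h1]
  | hT g =>
    rw [matrixHom_T, mul_assoc, CKFamily.T_mul_S_eq_ite', apply_ite (cutHom K hVW hV), cutHom_T,
      map_zero, mul_ite, CKFamily.T_mul_P_eq_ite, mul_zero]
    by_cases h1 : e' = g
    · subst h1
      by_cases h2 : E.src e' ∈ W
      · by_cases h3 : E.src e = E.rng e'
        · by_cases h4 : E.rng e' ∈ V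
          · simp [h2, h3, h4]
          · simp [h4, h3, (subFamily K W).T_eq_zero e fun h => hr e' h2 h4 (h3 ▸ h.1)]
        · simp [h3]
      · simp [h2]
    · simp [h1, Ne.symm h1]
  | hadd a b ha hb =>
    rw [map_add, Matrix.add_apply, map_add, ha, hb, mul_add, add_mul]
  | hmul a b ha hb =>
    rw [map_mul, Matrix.mul_apply, map_sum]
    simp only [map_mul, ha, hb]
    rw [← mul_assoc, mul_assoc _ b, mul_eq_sum_mul_S_mul_T_mul hW (_ * a)]
    simp only [mul_assoc]

/-- The counterpart that gives injectivity of `cutHom`: the image of b determines all T_e b S_{e'}.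
-/
lemma matrixHom_cutHom_apply (b : (E.induce V).LeavittPathAlgebra K) (e e' : E.Edge) :
    matrixHom K hW hVW hV (cutHom K hVW hV b) e e' =
      (subFamily K V).T e * b * (subFamily K V).S e' := by
  have happ (e e' : E.Edge) (p : Prop) [Decidable p] (a : (E.induce W).LeavittPathAlgebra K) :
      matrixHom K hW hVW hV (if p then a else 0) e e' =
        if p then matrixHom K hW hVW hV a e e' else 0 := by
    split_ifs
    · rfl
    · rw [map_zero]; rfl
  induction b using subFamily_induction generalizing e e' with
  | hzero => simp
  | hsmul c a ha => simp [map_smul, Matrix.smul_apply, ha]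
  | hP x =>
    rw [cutHom_P, happ, matrixHom_P, CKFamily.T_mul_P_eq_ite, ite_mul, CKFamily.T_mul_S_eq_ite',
      zero_mul]
    by_cases h4 : E.src e = x
    · subst h4
      by_cases h1 : E.src e ∈ V
      · simp [h1, hVW h1]
      · simp [h1]
    · simp [h4]
  | hS g =>
    rw [cutHom_S, happ, matrixHom_S, CKFamily.T_mul_S_eq_ite', ite_mul, CKFamily.P_mul_S_eq_ite,
      zero_mul]
    by_cases h1 : e = g
    · subst h1
      by_cases h2 : E.src e ∈ V
      · simp [h2, hVW h2, eq_comm]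
      · simp [h2]
    · simp [h1]
  | hT g =>
    rw [cutHom_T, happ, matrixHom_T, mul_assoc, CKFamily.T_mul_S_eq_ite', mul_ite,
      CKFamily.T_mul_P_eq_ite, mul_zero]
    by_cases h1 : e' = g
    · subst h1
      by_cases h2 : E.src e' ∈ V
      · simp [h2, hVW h2]
      · simp [h2]
    · simp [h1, Ne.symm h1]
  | hadd a b ha hb =>
    rw [map_add, map_add, Matrix.add_apply, ha, hb, mul_add, add_mul]
  | hmul a b ha hb =>
    rw [map_mul, map_mul, Matrix.mul_apply]
    simp only [ha, hb]
    rw [← mul_assoc, mul_assoc _ b, mul_eq_sum_mul_S_mul_T_mul (hW.of_subset hVW hV) (_ * a)]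
    simp only [mul_assoc]

/-- Since b = ∑ S_e (T_e b S_{e'}) T_{e'}, injectivity follows from recovering the bracketed
entries. Putting the matrix entries of a in their place gives a preimage of the corner element of a.
-/
lemma isCornerEmbedding_cutHom (hW : NoSinks W) :
    IsCornerEmbedding (cutHom K hVW hV : (E.induce V).LeavittPathAlgebra K →ₙ+*
      (E.induce W).LeavittPathAlgebra K) where
  injective := by
    have hV' := hW.of_subset hVW hV
    intro b b' h
    have h' (e e' : E.Edge) : (subFamily K V).T e * b * (subFamily K V).S e' =
        (subFamily K V).T e * b' * (subFamily K V).S e' := by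
      rw [← matrixHom_cutHom_apply hW hVW hV, ← matrixHom_cutHom_apply hW hVW hV]
      exact congrFun (congrFun (congrArg _ h) e) e'
    have key (b : (E.induce V).LeavittPathAlgebra K) :
        b = ∑ e, ∑ e', (subFamily K V).S e *
          ((subFamily K V).T e * b * (subFamily K V).S e') * (subFamily K V).T e' := by
      calc b = 1 * b * 1 := by rw [one_mul, mul_one]
        _ = _ := by
          rw [← sum_subFamily_S_mul_T hV']
          simp only [Finset.sum_mul, Finset.mul_sum, mul_assoc]
          exact Finset.sum_comm
    rw [key b, key b']
    simp only [h']
  exists_eq a := by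
    refine ⟨∑ e, ∑ e', (subFamily K V).S e * matrixHom K hW hVW hV a e e' *
      (subFamily K V).T e', ?_⟩
    change cutHom K hVW hV _ = cutHom K hVW hV 1 * a * cutHom K hVW hV 1
    simp only [map_sum, map_mul, cutHom_matrixHom_apply]
    have hV' := hW.of_subset hVW hV
    -- One restricted factor suffices: the image of S_e is already zero unless e starts in `V`, so
    -- T_e may be taken in the larger algebra.
    have h1 : cutHom K hVW hV 1 = ∑ e, cutHom K hVW hV ((subFamily K V).S e) *
        (subFamily K W).T e := by
      rw [← sum_subFamily_S_mul_T hV', map_sum]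
      refine Finset.sum_congr rfl fun e _ => ?_
      rw [map_mul, cutHom_T, cutHom_S]
      split_ifs <;> simp
    have h2 : cutHom K hVW hV 1 = ∑ e, (subFamily K W).S e *
        cutHom K hVW hV ((subFamily K V).T e) := by
      rw [← sum_subFamily_S_mul_T hV', map_sum]
      refine Finset.sum_congr rfl fun e _ => ?_
      rw [map_mul, cutHom_T, cutHom_S]
      split_ifs <;> simp
    conv_rhs =>
      congr
      · rw [h1]
      · rw [h2]
    simp only [Finset.sum_mul, Finset.mul_sum, mul_assoc]
    exact Finset.sum_comm

/-- Every edge of `W` ends in `V`, so S_e = S_e P_{r(e)} absorbs the corner idempotent on the right.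
Hence 1 = ∑ S_e T_e lies in the ideal it generates. -/
lemma span_cutHom_one (hW : NoSinks W) :
    Ideal.span {a | ∃ x y, a = x * (cutHom K hVW hV : (E.induce V).LeavittPathAlgebra K →ₙ+*
      (E.induce W).LeavittPathAlgebra K) 1 * y} = ⊤ := by
  rw [Ideal.eq_top_iff_one, ← sum_subFamily_S_mul_T hW]
  refine Ideal.sum_mem _ fun e _ => Ideal.subset_span
    ⟨(subFamily K W).S e, (subFamily K W).T e, ?_⟩
  change _ = _ * cutHom K hVW hV 1 * _
  congr 1
  have h : cutHom K hVW hV 1 = ((subFamily K W).cut hVW hV).one := CKFamily.subLift_one _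
  have h1 : (subFamily K W).P (E.rng e) * cutHom K hVW hV 1 =
      if E.rng e ∈ V then (subFamily K W).P (E.rng e) else 0 := by
    rw [h, CKFamily.one, Finset.mul_sum, Finset.sum_eq_single (E.rng e)]
    · change _ * (if _ then _ else _) = _
      split_ifs
      · exact CKFamily.P_mul_self _ _
      · exact mul_zero _
    · intro x _ hx
      change _ * (if _ then _ else _) = _
      split_ifs
      · exact CKFamily.P_mul_of_ne _ _ _ hx.symm
      · exact mul_zero _
    · simp
  by_cases he : E.src e ∈ W ∧ E.rng e ∈ W
  · conv_rhs => rw [← CKFamily.S_mul_P, mul_assoc, h1, if_pos (hV e he.1 he.2)]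
    rw [CKFamily.S_mul_P]
  · rw [CKFamily.S_eq_zero _ e he, zero_mul]

variable (K) in
/-- Removing sources, but no sinks, from a finite graph without sinks does not change the module
category of its Leavitt path algebra. -/
lemma nonempty_equivalence_cut (hVW : V ⊆ W)
    (hV : ∀ e, E.src e ∈ W → E.rng e ∈ W → E.rng e ∈ V) (hW : NoSinks W) :
    Nonempty (ModuleCat.{max u v w} ((E.induce W).LeavittPathAlgebra K) ≌
      ModuleCat.{max u v w} ((E.induce V).LeavittPathAlgebra K)) := by
  have := (isCornerEmbedding_cutHom (K := K) hVW hV hW).isEquivalence (span_cutHom_one hVW hV hW)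
  exact ⟨(cornerFunctor.{max u v w, max u v w, max u v w} (cutHom K hVW hV :
    (E.induce V).LeavittPathAlgebra K →ₙ+* (E.induce W).LeavittPathAlgebra K)).asEquivalence⟩

end SourceRemoval

/-! ### A representation in which no vertex is zero. -/

section BranchingSystem

variable (K : Type w) [Field K] (E : DirectedGraph.{u, v}) [Fintype E.Edge]

/-- For a vertex that is not a sink, (outgoing edges) × ℕ is countably infinite. A bijection with ℕ
splits ℕ into one injective copy of itself for each outgoing edge. -/
lemma exists_branching : ∃ b : E.Edge → ℕ → ℕ,
    (∀ e e' n n', E.src e = E.src e' → b e n = b e' n' → e = e' ∧ n = n') ∧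
      ∀ x, ¬ E.IsSink x → ∀ m, ∃ e n, E.src e = x ∧ b e n = m := by
  have h (x : E.Vert) (hx : ¬ E.IsSink x) : Nonempty ({e // E.src e = x} × ℕ ≃ ℕ) := by
    simp only [IsSink, not_forall, not_not] at hx
    obtain ⟨e, he⟩ := hx
    have : Nonempty {e // E.src e = x} := ⟨⟨e, he⟩⟩
    obtain ⟨d⟩ := nonempty_denumerable ({e // E.src e = x} × ℕ)
    exact ⟨Denumerable.eqv _⟩
  have hs (e : E.Edge) : ¬ E.IsSink (E.src e) := fun h => h e rfl
  refine ⟨fun e n => (h _ (hs e)).some (⟨e, rfl⟩, n), ?_, ?_⟩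
  · intro e e' n n' hee' hb
    have key : ∀ x (hx : ¬ E.IsSink x) (he : E.src e = x) (he' : E.src e' = x),
        (h x hx).some (⟨e, he⟩, n) = (h x hx).some (⟨e', he'⟩, n') → e = e' ∧ n = n' := by
      intro x hx he he' hb
      have := (h x hx).some.injective hb
      exact ⟨congrArg (fun t => t.1.1) this, congrArg (fun t => t.2) this⟩
    -- The bijections are chosen per vertex; this moves the one at s(e') along the equality of
    -- sources.
    have transport : ∀ x (hx : ¬ E.IsSink x) (he' : E.src e' = x),
        (h x hx).some (⟨e', he'⟩, n') = (h _ (hs e')).some (⟨e', rfl⟩, n') := by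
      rintro x hx rfl
      rfl
    exact key _ (hs e) rfl hee'.symm (by rw [transport _ (hs e)]; exact hb)
  · intro x hx m
    obtain ⟨⟨⟨e, rfl⟩, n⟩, hn⟩ := (h x hx).some.surjective m
    exact ⟨e, n, rfl, hn⟩

variable {K E}

/-- The operator of a vertex on the functions on `E⁰ × ℕ`. -/
noncomputable def branchP (x : E.Vert) : Module.End K (E.Vert × ℕ → K) where
  toFun φ z := if z.1 = x then φ z else 0
  map_add' φ ψ := by
    ext z
    by_cases h : z.1 = x <;> simp [h]
  map_smul' c φ := by
    ext z
    by_cases h : z.1 = x <;> simp [h]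

/-- The operator of an edge on the functions on `E⁰ × ℕ`. -/
noncomputable def branchS (b : E.Edge → ℕ → ℕ) (e : E.Edge) : Module.End K (E.Vert × ℕ → K) where
  toFun φ z := if z.1 = E.src e then
    Function.ExtendByZero.linearMap K (b e) (fun n => φ (E.rng e, n)) z.2 else 0
  map_add' φ ψ := by
    ext z
    simp only [Pi.add_apply]
    rw [show (fun n => φ (E.rng e, n) + ψ (E.rng e, n)) =
      (fun n => φ (E.rng e, n)) + fun n => ψ (E.rng e, n) from rfl, map_add, Pi.add_apply]
    by_cases h : z.1 = E.src e <;> simp [h]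
  map_smul' c φ := by
    ext z
    simp only [Pi.smul_apply]
    rw [show (fun n => c • φ (E.rng e, n)) = c • (fun n => φ (E.rng e, n)) from rfl, map_smul,
      Pi.smul_apply]
    by_cases h : z.1 = E.src e <;> simp [h]

/-- The operator of a ghost edge on the functions on `E⁰ × ℕ`. -/
noncomputable def branchT (b : E.Edge → ℕ → ℕ) (e : E.Edge) : Module.End K (E.Vert × ℕ → K) where
  toFun φ z := if z.1 = E.rng e then φ (E.src e, b e z.2) else 0
  map_add' φ ψ := by
    ext z
    by_cases h : z.1 = E.rng e <;> simp [h]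
  map_smul' c φ := by
    ext z
    by_cases h : z.1 = E.rng e <;> simp [h]

omit [Fintype E.Edge] in
lemma branchP_apply (x : E.Vert) (φ : E.Vert × ℕ → K) (z : E.Vert × ℕ) :
    branchP x φ z = if z.1 = x then φ z else 0 := rfl

omit [Fintype E.Edge] in
lemma branchS_apply (b : E.Edge → ℕ → ℕ) (e : E.Edge) (φ : E.Vert × ℕ → K) (z : E.Vert × ℕ) :
    branchS b e φ z =
      if z.1 = E.src e then Function.extend (b e) (fun n => φ (E.rng e, n)) 0 z.2 else 0 := rfl

omit [Fintype E.Edge] in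
lemma branchT_apply (b : E.Edge → ℕ → ℕ) (e : E.Edge) (φ : E.Vert × ℕ → K) (z : E.Vert × ℕ) :
    branchT b e φ z = if z.1 = E.rng e then φ (E.src e, b e z.2) else 0 := rfl

variable (K) in
/-- The family of operators given by a branching system. -/
noncomputable def branchingFamily (b : E.Edge → ℕ → ℕ)
    (hb : ∀ e e' n n', E.src e = E.src e' → b e n = b e' n' → e = e' ∧ n = n')
    (hb' : ∀ x, ¬ E.IsSink x → ∀ m, ∃ e n, E.src e = x ∧ b e n = m) :
    CKFamily E Set.univ (Module.End K (E.Vert × ℕ → K)) where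
  P := branchP
  S := branchS b
  T := branchT b
  P_eq_zero x hx := (hx trivial).elim
  S_eq_zero e he := (he ⟨trivial, trivial⟩).elim
  T_eq_zero e he := (he ⟨trivial, trivial⟩).elim
  P_mul_self x := by
    ext φ z
    simp only [Module.End.mul_apply, branchP_apply]
    split_ifs <;> rfl
  P_mul_of_ne x y h := by
    refine LinearMap.ext fun φ => funext fun z => ?_
    simp only [Module.End.mul_apply, branchP_apply]
    split_ifs with h1 h2
    · exact (h (h1.symm.trans h2)).elim
    all_goals rfl
  P_mul_S e := by
    refine LinearMap.ext fun φ => funext fun z => ?_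
    simp only [Module.End.mul_apply, branchP_apply, branchS_apply]
    split_ifs <;> rfl
  S_mul_P e := by
    refine LinearMap.ext fun φ => funext fun z => ?_
    simp [Module.End.mul_apply, branchP_apply, branchS_apply]
  P_mul_T e := by
    refine LinearMap.ext fun φ => funext fun z => ?_
    simp only [Module.End.mul_apply, branchP_apply, branchT_apply]
    split_ifs <;> rfl
  T_mul_P e := by
    refine LinearMap.ext fun φ => funext fun z => ?_
    simp [Module.End.mul_apply, branchP_apply, branchT_apply]
  T_mul_S e _ _ := by
    refine LinearMap.ext fun φ => funext fun z => ?_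
    have hinj : Function.Injective (b e) := fun n n' h => (hb e e n n' rfl h).2
    obtain ⟨y, n⟩ := z
    simp only [Module.End.mul_apply, branchP_apply, branchT_apply, branchS_apply, if_true,
      hinj.extend_apply]
    split_ifs with h
    · rw [h]
    · rfl
  T_mul_S_of_ne e f hef := by
    refine LinearMap.ext fun φ => funext fun z => ?_
    simp only [Module.End.mul_apply, branchT_apply, branchS_apply]
    split_ifs with h h'
    · rw [Function.extend_apply']
      · rfl
      · rintro ⟨n, hn⟩
        exact hef (hb f e _ _ h'.symm hn).1.symm
    all_goals rfl
  P_eq_sum x hx _ := by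
    refine LinearMap.ext fun φ => funext fun z => ?_
    rw [LinearMap.sum_apply, Finset.sum_apply]
    have happ (e : E.Edge) : (if E.src e = x then branchS b e * branchT b e else 0 :
        Module.End K (E.Vert × ℕ → K)) φ z = if E.src e = x ∧ z.1 = x then
          Function.extend (b e) (fun n => φ (x, b e n)) 0 z.2 else 0 := by
      by_cases h : E.src e = x
      · simp only [h, if_true, true_and, Module.End.mul_apply, branchS_apply, branchT_apply]
      · simp only [h, if_false, false_and]
        rfl
    simp only [happ, branchP_apply]
    by_cases hz : z.1 = x
    · have hx' : ¬ E.IsSink x := by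
        obtain ⟨e, he, -⟩ := hx
        exact fun h => h e he
      obtain ⟨e, n, he, hn⟩ := hb' x hx' z.2
      have hinj : Function.Injective (b e) := fun n n' h => (hb e e n n' rfl h).2
      rw [Finset.sum_eq_single e]
      · rw [if_pos hz, if_pos ⟨he, hz⟩, ← hn, hinj.extend_apply, hn, ← hz]
      · intro f _ hf
        split_ifs with h
        · rw [Function.extend_apply']
          · rfl
          · rintro ⟨m, hm⟩
            exact hf (hb f e m n (h.1.trans he.symm) (hm.trans hn.symm)).1
        · rfl
      · simp
    · simp [hz]

-- In the branching representation x acts as restriction of functions to {x} × ℕ, which does not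
-- kill the constant function 1.
variable (K) in
lemma lVert_ne_zero [Fintype E.Vert] (x : E.Vert) : lVert K x ≠ 0 := by
  obtain ⟨b, hb, hb'⟩ := exists_branching E
  intro h
  have h1 : (branchP x : Module.End K (E.Vert × ℕ → K)) = 0 := by
    have := (branchingFamily K b hb hb').lift_vert (K := K) x
    rw [h, map_zero] at this
    exact this.symm
  have h2 := congrFun (DFunLike.congr_fun h1 (fun _ => 1)) (x, 0)
  rw [branchP_apply, if_pos rfl] at h2
  exact one_ne_zero h2

end BranchingSystem

/-! ### The corner at the sinks is a product of copies of K. -/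

section Sinks

variable (K : Type w) [Field K] (E : DirectedGraph.{u, v}) [Fintype E.Vert] [Fintype E.Edge]

/-- The embedding of the functions on the sinks in the Leavitt path algebra. -/
noncomputable def sinkHom : ({x : E.Vert // E.IsSink x} → K) →ₙ+* E.LeavittPathAlgebra K where
  toFun c := ∑ x, c x • lVert K x.1
  map_zero' := by simp
  map_add' c d := by simp [add_smul, Finset.sum_add_distrib]
  map_mul' c d := by
    have h (x y : {x : E.Vert // E.IsSink x}) :
        lVert K x.1 * lVert K y.1 = if x = y then lVert K x.1 else 0 := by
      exact ((leavittFamily K E).P_mul_P x.1 y.1).trans (if_congr Subtype.ext_iff.symm rfl rfl)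
    simp only [Finset.sum_mul_sum, smul_mul_smul_comm, h, smul_ite, smul_zero]
    simp

variable {K E}

lemma sinkHom_apply (c : {x : E.Vert // E.IsSink x} → K) :
    sinkHom K E c = ∑ x, c x • lVert K x.1 := rfl

lemma lVert_mul_lVert (x y : E.Vert) :
    lVert K x * lVert K y = if x = y then lVert K x else 0 :=
  (leavittFamily K E).P_mul_P x y

lemma lVert_mul_sinkHom (x : {x : E.Vert // E.IsSink x}) (c : {x : E.Vert // E.IsSink x} → K) :
    lVert K x.1 * sinkHom K E c = c x • lVert K x.1 := by
  rw [sinkHom_apply, Finset.mul_sum, Finset.sum_eq_single x]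
  · rw [mul_smul_comm, lVert_mul_lVert, if_pos rfl]
  · intro y _ hy
    rw [mul_smul_comm, lVert_mul_lVert, if_neg fun h => hy (Subtype.ext h.symm), smul_zero]
  · simp

lemma sinkHom_one_mul_lVert (x : {x : E.Vert // E.IsSink x}) :
    sinkHom K E 1 * lVert K x.1 = lVert K x.1 := by
  rw [sinkHom_apply, Finset.sum_mul, Finset.sum_eq_single x]
  · rw [smul_mul_assoc, lVert_mul_lVert, if_pos rfl, Pi.one_apply, one_smul]
  · intro y _ hy
    rw [smul_mul_assoc, lVert_mul_lVert, if_neg fun h => hy (Subtype.ext h), smul_zero]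
  · simp

/-- The span of the ghost paths that start at `x`. -/
noncomputable def ghostSpan (K : Type w) [Field K] (x : E.Vert) :
    Submodule K (E.LeavittPathAlgebra K) :=
  Submodule.span K (Set.range fun l : List E.Edge => lVert K x * (l.map (lGhost K)).prod)

lemma ghostSpan_mul_mem {x : E.Vert} {a : E.LeavittPathAlgebra K}
    (h : ∀ l : List E.Edge, lVert K x * (l.map (lGhost K)).prod * a ∈ ghostSpan K x)
    {d : E.LeavittPathAlgebra K} (hd : d ∈ ghostSpan K x) : d * a ∈ ghostSpan K x := by
  induction hd using Submodule.span_induction with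
  | mem d hd =>
    obtain ⟨l, rfl⟩ := hd
    exact h l
  | zero => rw [zero_mul]; exact Submodule.zero_mem _
  | add d d' _ _ hd hd' => rw [add_mul]; exact Submodule.add_mem _ hd hd'
  | smul c d _ hd => rw [smul_mul_assoc]; exact Submodule.smul_mem _ c hd

/-- Check generators: a ghost edge lengthens the path, a vertex fixes or kills it. An edge meets
either the sink x, giving 0, or a last ghost edge, which it cancels to a vertex or 0. -/
lemma ghostSpan_mul {x : E.Vert} (hx : E.IsSink x) (a : E.LeavittPathAlgebra K) :
    ∀ d ∈ ghostSpan K x, d * a ∈ ghostSpan K x := by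
  have hmem (l : List E.Edge) : lVert K x * (l.map (lGhost K)).prod ∈ ghostSpan K x :=
    Submodule.subset_span ⟨l, rfl⟩
  have hv (y : E.Vert) (l : List E.Edge) :
      lVert K x * (l.map (lGhost K)).prod * lVert K y ∈ ghostSpan K x := by
    rcases List.eq_nil_or_concat l with rfl | ⟨l, g, rfl⟩
    · rw [List.map_nil, List.prod_nil, mul_one, lVert_mul_lVert]
      split_ifs
      · simpa using hmem []
      · exact Submodule.zero_mem _
    · have : lGhost K g * lVert K y = if E.src g = y then lGhost K g else 0 :=
        (leavittFamily K E).T_mul_P_eq_ite g y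
      have hl := hmem (l.concat g)
      rw [List.concat_eq_append, List.map_append, List.prod_append, List.map_singleton,
        List.prod_singleton] at hl ⊢
      rw [mul_assoc, mul_assoc, this]
      split_ifs
      · exact hl
      · simp
  induction a using leavitt_induction with
  | hK c =>
    intro d hd
    rw [Algebra.algebraMap_eq_smul_one, mul_smul_comm, mul_one]
    exact Submodule.smul_mem _ c hd
  | hv y => exact fun d => ghostSpan_mul_mem (hv y)
  | he e =>
    refine fun d => ghostSpan_mul_mem fun l => ?_
    rcases List.eq_nil_or_concat l with rfl | ⟨l, g, rfl⟩
    · have : lVert K x * lEdge K e = if x = E.src e then lEdge K e else 0 :=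
        (leavittFamily K E).P_mul_S_eq_ite x e
      rw [List.map_nil, List.prod_nil, mul_one, this, if_neg fun h => hx e h.symm]
      exact Submodule.zero_mem _
    · have : lGhost K g * lEdge K e = if g = e then lVert K (E.rng g) else 0 :=
        (leavittFamily K E).T_mul_S_eq_ite g e trivial
      rw [List.concat_eq_append, List.map_append, List.prod_append, List.map_singleton,
        List.prod_singleton, mul_assoc, mul_assoc, this]
      split_ifs
      · rw [← mul_assoc]
        exact hv _ l
      · simp
  | hg e =>
    refine fun d => ghostSpan_mul_mem fun l => ?_
    have := hmem (l ++ [e])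
    rwa [List.map_append, List.prod_append, List.map_singleton, List.prod_singleton,
      ← mul_assoc] at this
  | hadd a b ha hb =>
    intro d hd
    rw [mul_add]
    exact Submodule.add_mem _ (ha d hd) (hb d hd)
  | hmul a b ha hb =>
    intro d hd
    rw [← mul_assoc]
    exact hb _ (ha d hd)

/-- Of the ghost paths spanning xL only the empty one survives right multiplication by y, because no
edge starts at the sink y. -/
lemma exists_lVert_mul_mul_lVert {x y : E.Vert} (hx : E.IsSink x) (hy : E.IsSink y)
    (a : E.LeavittPathAlgebra K) : ∃ c : K, lVert K x * a * lVert K y = c • lVert K x := by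
  have h : lVert K x * a ∈ ghostSpan K x :=
    ghostSpan_mul hx a _ (Submodule.subset_span ⟨[], by simp⟩)
  generalize lVert K x * a = d at h
  induction h using Submodule.span_induction with
  | mem d hd =>
    obtain ⟨l, rfl⟩ := hd
    dsimp only
    rcases List.eq_nil_or_concat l with rfl | ⟨l, g, rfl⟩
    · rw [List.map_nil, List.prod_nil, mul_one, lVert_mul_lVert]
      split_ifs
      · exact ⟨1, (one_smul _ _).symm⟩
      · exact ⟨0, (zero_smul _ _).symm⟩
    · have : lGhost K g * lVert K y = if E.src g = y then lGhost K g else 0 :=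
        (leavittFamily K E).T_mul_P_eq_ite g y
      refine ⟨0, ?_⟩
      rw [List.concat_eq_append, List.map_append, List.prod_append, List.map_singleton,
        List.prod_singleton, mul_assoc, mul_assoc, this, if_neg (hy g), mul_zero, mul_zero,
        zero_smul]
  | zero => exact ⟨0, by rw [zero_mul, zero_smul]⟩
  | add d d' _ _ hd hd' =>
    obtain ⟨c, hc⟩ := hd
    obtain ⟨c', hc'⟩ := hd'
    exact ⟨c + c', by rw [add_mul, hc, hc', add_smul]⟩
  | smul k d _ hd =>
    obtain ⟨c, hc⟩ := hd
    exact ⟨k * c, by rw [smul_mul_assoc, hc, mul_smul]⟩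

variable (K E) in
lemma isCornerEmbedding_sinkHom : IsCornerEmbedding (sinkHom K E) where
  injective := by
    rw [injective_iff_map_eq_zero]
    intro c hc
    ext x
    have h := lVert_mul_sinkHom x c
    rw [hc, mul_zero] at h
    exact (smul_eq_zero.1 h.symm).resolve_right (lVert_ne_zero K x.1)
  exists_eq a := by
    choose c hc using fun x y : {x : E.Vert // E.IsSink x} =>
      exists_lVert_mul_mul_lVert (K := K) x.2 y.2 a
    have hc' (x y : {x : E.Vert // E.IsSink x}) :
        lVert K x.1 * (a * lVert K y.1) = if x = y then c x x • lVert K x.1 else 0 := by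
      rw [← mul_assoc]
      split_ifs with h
      · subst h
        exact hc x x
      · have h' : (x : E.Vert) ≠ y := fun h' => h (Subtype.ext h')
        have hy : lVert K y.1 * lVert K y.1 = lVert K y.1 := by
          rw [lVert_mul_lVert, if_pos rfl]
        -- For x ≠ y, xay = (xay)y is a multiple of xy = 0.
        rw [← hy, ← mul_assoc, hc, smul_mul_assoc, lVert_mul_lVert, if_neg h', smul_zero]
    refine ⟨fun x => c x x, ?_⟩
    simp only [sinkHom_apply, Pi.one_apply, one_smul, Finset.sum_mul, Finset.mul_sum, mul_assoc,
      hc']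
    simp

end Sinks

/-! ### Vertices on infinite paths and vertices that survive all rounds. -/

section SurvivingVertices

variable {E : DirectedGraph.{u, v}}

/-- The vertices from which infinite paths start. -/
def infiniteEmitters (E : DirectedGraph.{u, v}) : Set E.Vert := {x | ∃ W, NoSinks W ∧ x ∈ W}

lemma NoSinks.subset_infiniteEmitters {W : Set E.Vert} (hW : NoSinks W) :
    W ⊆ E.infiniteEmitters := fun _ hx => ⟨W, hW, hx⟩

lemma noSinks_infiniteEmitters : NoSinks E.infiniteEmitters := by
  rintro x ⟨W, hW, hx⟩
  obtain ⟨e, he, he'⟩ := hW x hx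
  exact ⟨e, he, W, hW, he'⟩

/-- Adding a predecessor to a set without sinks creates no sink. -/
lemma src_mem_infiniteEmitters (e : E.Edge) (he : E.rng e ∈ E.infiniteEmitters) :
    E.src e ∈ E.infiniteEmitters := by
  refine ⟨insert (E.src e) E.infiniteEmitters, ?_, Set.mem_insert _ _⟩
  rintro x (rfl | hx)
  · exact ⟨e, rfl, Set.mem_insert_of_mem _ he⟩
  · obtain ⟨f, hf, hf'⟩ := noSinks_infiniteEmitters x hx
    exact ⟨f, hf, Set.mem_insert_of_mem _ hf'⟩

lemma mem_remaining_succ {n : ℕ} {x : E.Vert} : x ∈ E.remaining (n + 1) ↔ x ∈ E.remaining n ∧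
    (∃ e, E.src e = x ∧ E.rng e ∈ E.remaining n) ∧
      ∃ e, E.rng e = x ∧ E.src e ∈ E.remaining n := by
  constructor
  · rintro ⟨hx, h, h'⟩
    simp only [IsSink, IsSource, not_forall, not_not] at h h'
    obtain ⟨e, he⟩ := h
    obtain ⟨f, hf⟩ := h'
    exact ⟨hx, ⟨e.1, congrArg Subtype.val he, e.2.2⟩, f.1, congrArg Subtype.val hf, f.2.1⟩
  · rintro ⟨hx, ⟨e, rfl, he⟩, f, hf, hf'⟩
    exact ⟨hx, fun h => h ⟨e, hx, he⟩ rfl, fun h => h ⟨f, hf', hf ▸ hx⟩ (Subtype.ext hf)⟩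

lemma subset_iInter_remaining {W : Set E.Vert} (hW : NoSinks W)
    (hW' : ∀ x ∈ W, ∃ e, E.rng e = x ∧ E.src e ∈ W) : W ⊆ ⋂ n, E.remaining n := by
  refine Set.subset_iInter fun n => ?_
  induction n with
  | zero => exact Set.subset_univ _
  | succ n ih =>
    intro x hx
    obtain ⟨e, he, he'⟩ := hW x hx
    obtain ⟨f, hf, hf'⟩ := hW' x hx
    exact mem_remaining_succ.2 ⟨ih hx, ⟨e, he, ih he'⟩, f, hf, ih hf'⟩

/-- A decreasing sequence of subsets of a finite set stabilises. Two consecutive stable indices are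
given so that one round can be read as a statement about the intersection. -/
lemma exists_remaining_eq_iInter [Finite E.Vert] :
    ∃ n, E.remaining n = ⋂ m, E.remaining m ∧ E.remaining (n + 1) = ⋂ m, E.remaining m := by
  have hanti : Antitone E.remaining :=
    antitone_nat_of_succ_le fun n x hx => (mem_remaining_succ.1 hx).1
  obtain ⟨n, hn⟩ := WellFoundedGT.monotone_chain_condition
    (⟨fun n => OrderDual.toDual (E.remaining n), fun _ _ h => hanti h⟩ : ℕ →o (Set E.Vert)ᵒᵈ)
  have hn' (m : ℕ) (hm : n ≤ m) : E.remaining n = E.remaining m := hn m hm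
  have h : E.remaining n = ⋂ m, E.remaining m := by
    refine Set.Subset.antisymm (Set.subset_iInter fun m => ?_) (Set.iInter_subset _ n)
    rcases le_total n m with h | h
    · exact (hn' m h).subset
    · exact hanti h
  exact ⟨n, h, (hn' _ n.le_succ).symm.trans h⟩

lemma noSinks_iInter_remaining [Finite E.Vert] : NoSinks (⋂ n, E.remaining n) := by
  obtain ⟨n, hn, hn'⟩ := exists_remaining_eq_iInter (E := E)
  intro x hx
  rw [← hn'] at hx
  rw [← hn]
  exact (mem_remaining_succ.1 hx).2.1

lemma exists_rng_eq_of_mem_iInter_remaining [Finite E.Vert] {x : E.Vert}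
    (hx : x ∈ ⋂ n, E.remaining n) : ∃ e, E.rng e = x ∧ E.src e ∈ ⋂ n, E.remaining n := by
  obtain ⟨n, hn, hn'⟩ := exists_remaining_eq_iInter (E := E)
  rw [← hn'] at hx
  rw [← hn]
  exact (mem_remaining_succ.1 hx).2.2

end SurvivingVertices

/-! ### Iterated source removal, and the quotient that kills the sinks. -/

section

variable (K : Type w) [Field K] (E : DirectedGraph.{u, v}) [Fintype E.Vert] [Fintype E.Edge]

/-- Well-founded induction on `W`: one round keeps the vertices that receive an edge from `W`. If
nothing is removed, every vertex of `W` has an edge in and an edge out, so `W` survives all rounds.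
-/
lemma nonempty_equivalence_of_noSinks (W : Set E.Vert) (hW : NoSinks W)
    (hW' : ⋂ n, E.remaining n ⊆ W) :
    Nonempty (ModuleCat.{max u v w} ((E.induce W).LeavittPathAlgebra K) ≌
      ModuleCat.{max u v w} ((E.induce (⋂ n, E.remaining n)).LeavittPathAlgebra K)) := by
  induction W using WellFoundedLT.induction with
  | ind W ih =>
  let V : Set E.Vert := {x ∈ W | ∃ e, E.rng e = x ∧ E.src e ∈ W}
  have hVW : V ⊆ W := fun x hx => hx.1
  have hV (e) (he : E.src e ∈ W) (he' : E.rng e ∈ W) : E.rng e ∈ V := ⟨he', e, rfl, he⟩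
  by_cases h : V = W
  · have : W = ⋂ n, E.remaining n := Set.Subset.antisymm
      (subset_iInter_remaining hW fun x hx => (h.symm ▸ hx : x ∈ V).2) hW'
    rw [this]
    exact ⟨CategoryTheory.Equivalence.refl⟩
  · obtain ⟨e⟩ := nonempty_equivalence_cut K hVW hV hW
    obtain ⟨e'⟩ := ih V (LE.le.ssubset_of_ne hVW h) (hW.of_subset hVW hV) fun x hx => by
      obtain ⟨f, hf, hf'⟩ := exists_rng_eq_of_mem_iInter_remaining hx
      exact ⟨hW' hx, f, hf, hW' hf'⟩
    exact ⟨e.trans e'⟩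

/-- The quotient map of the Leavitt path algebra that kills the vertices from which only finitely
many paths start. -/
noncomputable def killHom : E.LeavittPathAlgebra K →+*
    (E.induce E.infiniteEmitters).LeavittPathAlgebra K :=
  -- Extension by zero respects the relations of E because this set is closed under predecessors and
  -- has no sinks.
  let F := (subFamily K E.infiniteEmitters).enlarge noSinks_infiniteEmitters
    src_mem_infiniteEmitters
  { (F.lift : E.LeavittPathAlgebra K →ₙₐ[K] _) with
    map_one' := F.lift_one.trans (one_subFamily K E.infiniteEmitters) }

variable {K E}

lemma killHom_algebraMap (c : K) : killHom K E (algebraMap K _ c) = algebraMap K _ c := by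
  rw [Algebra.algebraMap_eq_smul_one, Algebra.algebraMap_eq_smul_one, ← map_one (killHom K E)]
  exact map_smul (((subFamily K E.infiniteEmitters).enlarge noSinks_infiniteEmitters
    src_mem_infiniteEmitters).lift : E.LeavittPathAlgebra K →ₙₐ[K] _) c 1

lemma killHom_vert (x : E.Vert) :
    killHom K E (lVert K x) = (subFamily K E.infiniteEmitters).P x :=
  CKFamily.lift_vert _ x

lemma killHom_edge (e : E.Edge) :
    killHom K E (lEdge K e) = (subFamily K E.infiniteEmitters).S e :=
  CKFamily.lift_edge _ e

lemma killHom_ghost (e : E.Edge) :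
    killHom K E (lGhost K e) = (subFamily K E.infiniteEmitters).T e :=
  CKFamily.lift_ghost _ e

lemma killHom_surjective : Function.Surjective (killHom K E) := by
  intro a
  induction a using subFamily_induction with
  | hzero => exact ⟨0, map_zero _⟩
  | hsmul c a ha =>
    obtain ⟨b, rfl⟩ := ha
    refine ⟨algebraMap K _ c * b, ?_⟩
    rw [map_mul, killHom_algebraMap, Algebra.smul_def]
  | hP x => exact ⟨_, killHom_vert x⟩
  | hS e => exact ⟨_, killHom_edge e⟩
  | hT e => exact ⟨_, killHom_ghost e⟩
  | hadd a b ha hb =>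
    obtain ⟨a, rfl⟩ := ha
    obtain ⟨b, rfl⟩ := hb
    exact ⟨a + b, map_add _ _ _⟩
  | hmul a b ha hb =>
    obtain ⟨a, rfl⟩ := ha
    obtain ⟨b, rfl⟩ := hb
    exact ⟨a * b, map_mul _ _ _⟩

/-- The image of a family under an algebra homomorphism that kills the vertices outside `W`. -/
def CKFamily.mapVanishing {A B : Type*} [Ring A] [Ring B] (F : CKFamily E Set.univ A) (f : A →+* B)
    (W : Set E.Vert) (hW : ∀ x, x ∉ W → f (F.P x) = 0) : CKFamily E W B where
  P x := f (F.P x)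
  S e := f (F.S e)
  T e := f (F.T e)
  P_eq_zero := hW
  S_eq_zero e he := by
    by_cases h : E.src e ∈ W
    · rw [← F.S_mul_P, map_mul, hW _ fun h' => he ⟨h, h'⟩, mul_zero]
    · rw [← F.P_mul_S, map_mul, hW _ h, zero_mul]
  T_eq_zero e he := by
    by_cases h : E.src e ∈ W
    · rw [← F.P_mul_T, map_mul, hW _ fun h' => he ⟨h, h'⟩, zero_mul]
    · rw [← F.T_mul_P, map_mul, hW _ h, mul_zero]
  P_mul_self x := by rw [← map_mul, F.P_mul_self]
  P_mul_of_ne x y h := by rw [← map_mul, F.P_mul_of_ne x y h, map_zero]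
  P_mul_S e := by rw [← map_mul, F.P_mul_S]
  S_mul_P e := by rw [← map_mul, F.S_mul_P]
  P_mul_T e := by rw [← map_mul, F.P_mul_T]
  T_mul_P e := by rw [← map_mul, F.T_mul_P]
  T_mul_S e _ _ := by rw [← map_mul, F.T_mul_S e trivial trivial]
  T_mul_S_of_ne e f h := by rw [← map_mul, F.T_mul_S_of_ne e f h, map_zero]
  P_eq_sum x hx _ := by
    obtain ⟨e, he, -⟩ := hx
    rw [F.P_eq_sum x ⟨e, he, trivial⟩ trivial, map_sum]
    exact Finset.sum_congr rfl fun e _ => by split_ifs <;> simp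

/-- The universal property of the quotient, without computing a kernel: the images of the generators
form a family for the subgraph, and such a family defines g. -/
lemma exists_ringHom_comp_killHom {B : Type*} [Ring B] [Algebra K B]
    (f : E.LeavittPathAlgebra K →ₐ[K] B) (hf : ∀ x, x ∉ E.infiniteEmitters → f (lVert K x) = 0) :
    ∃ g : (E.induce E.infiniteEmitters).LeavittPathAlgebra K →+* B,
      ∀ a, g (killHom K E a) = f a := by
  let F := (leavittFamily K E).mapVanishing (f : E.LeavittPathAlgebra K →+* B)
    E.infiniteEmitters hf
  have h1 : F.subLift (1 : (E.induce E.infiniteEmitters).LeavittPathAlgebra K) = 1 := by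
    rw [CKFamily.subLift_one]
    change ∑ x, f ((leavittFamily K E).P x) = 1
    rw [← map_sum]
    exact (congrArg f one_leavittFamily).trans (map_one f)
  refine ⟨{ (F.subLift : _ →ₙₐ[K] B) with map_one' := h1 }, fun a => ?_⟩
  change F.subLift (killHom K E a) = f a
  induction a using leavitt_induction with
  | hK c =>
    rw [killHom_algebraMap, Algebra.algebraMap_eq_smul_one, map_smul, h1, AlgHom.commutes,
      Algebra.algebraMap_eq_smul_one]
  | hv x => rw [killHom_vert, CKFamily.subLift_P]; rfl
  | he e => rw [killHom_edge, CKFamily.subLift_S]; rfl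
  | hg e => rw [killHom_ghost, CKFamily.subLift_T]; rfl
  | hadd a b ha hb => rw [map_add, map_add, map_add, ha, hb]
  | hmul a b ha hb => rw [map_mul, map_mul, map_mul, ha, hb]

/-- The vertices acting nontrivially form a set without sinks: such an x is not a sink of E, so x =
∑ S_e P_{r(e)} T_e, and some r(e) must act nontrivially too. -/
lemma lVert_smul_eq_zero {M : Type*} [AddCommGroup M] [Module (E.LeavittPathAlgebra K) M]
    (hM : ∀ x, E.IsSink x → ∀ m : M, lVert K x • m = 0) (x : E.Vert)
    (hx : x ∉ E.infiniteEmitters) (m : M) : lVert K x • m = 0 := by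
  by_contra hm
  have h : NoSinks {x : E.Vert | ∃ m : M, lVert K x • m ≠ 0} := by
    rintro x ⟨m, hm⟩
    by_contra! h
    have hxs : ¬ E.IsSink x := fun hxs => hm (hM x hxs m)
    simp only [IsSink, not_forall, not_not] at hxs
    obtain ⟨e, he⟩ := hxs
    apply hm
    have := (leavittFamily K E).P_eq_sum x ⟨e, he, trivial⟩ trivial
    rw [show lVert K x = _ from this, Finset.sum_smul]
    refine Finset.sum_eq_zero fun e _ => ?_
    split_ifs with he
    · have hr (m : M) : lVert K (E.rng e) • m = 0 := by
        by_contra hr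
        exact h e he ⟨m, hr⟩
      rw [← (leavittFamily K E).S_mul_P, mul_assoc, mul_smul, mul_smul]
      exact (congrArg _ (hr _)).trans (smul_zero _)
    · exact zero_smul _ _
  exact hx (h.subset_infiniteEmitters ⟨m, hm⟩)

end

/-! ### The kernel of the corner functor, and the recollement. -/

section

variable {R : Type u} {S : Type v} [Ring R] [Ring S]

/-- Restriction of scalars along a surjective ring homomorphism is fully faithful. -/
noncomputable def fullyFaithfulRestrictScalars {f : R →+* S} (hf : Function.Surjective f) :
    (ModuleCat.restrictScalars.{w} f).FullyFaithful where
  preimage {M N} g := ModuleCat.ofHom (X := M) (Y := N)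
    { toFun := fun m => g.hom m
      map_add' := fun m n => map_add g.hom m n
      map_smul' := fun s m => by
        obtain ⟨r, rfl⟩ := hf s
        exact map_smul g.hom r (show (ModuleCat.restrictScalars f).obj M from m) }

end

-- A sink starts no infinite path, so it acts as zero on restricted modules. Conversely, once the
-- sinks act as zero, so do all vertices killed by `killHom`, and the action factors through the
-- quotient.
open scoped ModuleCat.Algebra in
lemma essImage_restrictScalars_killHom_iff (K : Type w) [Field K] (E : DirectedGraph.{u, v})
    [Fintype E.Vert] [Fintype E.Edge] (M : ModuleCat.{max u v w} (E.LeavittPathAlgebra K)) :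
    (ModuleCat.restrictScalars.{max u v w} (killHom K E)).essImage M ↔
      ∀ x, E.IsSink x → ∀ m : M, lVert K x • m = 0 := by
  constructor
  · rintro ⟨N, ⟨e⟩⟩ x hx m
    have hx' : x ∉ E.infiniteEmitters := fun h => by
      obtain ⟨f, hf, -⟩ := noSinks_infiniteEmitters x h
      exact hx f hf
    let e' := e.toLinearEquiv
    have h : e'.symm (lVert K x • m) = 0 := by
      rw [map_smul]
      change killHom K E (lVert K x) • (show N from e'.symm m) = 0
      rw [killHom_vert, CKFamily.P_eq_zero _ _ hx', zero_smul]
    exact e'.symm.map_eq_zero_iff.1 h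
  · intro hM
    obtain ⟨g, hg⟩ := exists_ringHom_comp_killHom
      (Algebra.lsmul K K M : E.LeavittPathAlgebra K →ₐ[K] Module.End K M) fun x hx =>
        LinearMap.ext fun m => lVert_smul_eq_zero hM x hx m
    let : Module ((E.induce E.infiniteEmitters).LeavittPathAlgebra K) M := Module.compHom M g
    let N := (ModuleCat.restrictScalars (killHom K E)).obj
      (ModuleCat.of ((E.induce E.infiniteEmitters).LeavittPathAlgebra K) M)
    let f : N ≃ₗ[E.LeavittPathAlgebra K] M :=
      { AddEquiv.refl M with
        map_smul' := fun a m => by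
          change (g (killHom K E a)) m = a • (show M from m)
          rw [hg]
          rfl }
    exact ⟨ModuleCat.of _ M, ⟨f.toModuleIso⟩⟩

/-- The idempotent is the sum of the sinks, and it fixes xM for each sink x. -/
lemma isZero_cornerFunctor_sinkHom_iff (K : Type w) [Field K] (E : DirectedGraph.{u, v})
    [Fintype E.Vert] [Fintype E.Edge] (M : ModuleCat.{max u v w} (E.LeavittPathAlgebra K)) :
    IsZero ((cornerFunctor (sinkHom K E)).obj M) ↔
      ∀ x, E.IsSink x → ∀ m : M, lVert K x • m = 0 := by
  rw [ModuleCat.isZero_iff_subsingleton]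
  change Subsingleton (cornerPart (sinkHom K E) M) ↔ _
  constructor
  · intro h x hx m
    have hm : lVert K x • m ∈ cornerPart (sinkHom K E) M := by
      rw [mem_cornerPart, smul_smul, sinkHom_one_mul_lVert ⟨x, hx⟩]
    exact congrArg Subtype.val (Subsingleton.elim (⟨_, hm⟩ : cornerPart (sinkHom K E) M) 0)
  · refine fun h => subsingleton_of_forall_eq 0 fun m => Subtype.ext ?_
    have hm := (mem_cornerPart _).1 m.2
    rw [← hm, sinkHom_apply, Finset.sum_smul]
    refine Finset.sum_eq_zero fun x _ => ?_
    rw [Pi.one_apply, one_smul]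
    exact h x.1 x.2 _

/-- The recollement of module categories of the Leavitt path algebra of a finite graph. -/
theorem nonempty_recollement (K : Type w) [Field K] (E : DirectedGraph.{u, v})
    [Finite E.Vert] [Finite E.Edge] :
    Nonempty (Recollement
      (ModuleCat.{max u v w} (E.removeSourcesSinks.LeavittPathAlgebra K))
      (ModuleCat.{max u v w} (E.LeavittPathAlgebra K))
      (ModuleCat.{max u v w} ({x : E.Vert // E.IsSink x} → K))) := by
  have := Fintype.ofFinite E.Vert
  have := Fintype.ofFinite E.Edge
  obtain ⟨e⟩ := nonempty_equivalence_of_noSinks K E _ noSinks_infiniteEmitters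
    noSinks_iInter_remaining.subset_infiniteEmitters
  let π := killHom K E
  let σ := sinkHom K E
  have : PreservesLimits (ModuleCat.restrictScalars.{max u v w} π) := ⟨⟨inferInstance⟩⟩
  have : (ModuleCat.restrictScalars.{max u v w} π).IsRightAdjoint :=
    ModuleCat.isRightAdjoint_of_preservesLimits _
  -- In an adjoint triple the left adjoint is fully faithful exactly when the right one is; this
  -- transfers the property from coinduction to s.
  let t : Adjunction.Triple (cornerFunctor.{max u v w, max u w, max u v w} σ).leftAdjoint
      (cornerFunctor σ) (coinducedFunctor.{max u v w, max u w, max u v w} σ) :=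
    { adj₁ := Adjunction.ofIsRightAdjoint _
      adj₂ := cornerAdjunction.{max u v w, max u w, max u v w} σ }
  have hr := (isCornerEmbedding_sinkHom K E).fullyFaithfulCoinduced.{max u v w, max u w, max u v w}
  have hff := fullyFaithfulRestrictScalars.{max u v w, max u v w, max u v w}
    (killHom_surjective (K := K) (E := E))
  exact ⟨
    { i := e.symm.functor ⋙ ModuleCat.restrictScalars.{max u v w} π
      p := ModuleCat.coextendScalars π ⋙ e.functor
      q := (ModuleCat.restrictScalars.{max u v w} π).leftAdjoint ⋙ e.functor
      j := cornerFunctor σ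
      r := coinducedFunctor.{max u v w, max u w, max u v w} σ
      s := (cornerFunctor.{max u v w, max u w, max u v w} σ).leftAdjoint
      adj_s_j := t.adj₁
      adj_j_r := t.adj₂
      adj_q_i := (Adjunction.ofIsRightAdjoint _).comp e.toAdjunction
      adj_i_p := e.symm.toAdjunction.comp (ModuleCat.restrictCoextendScalarsAdj π)
      fullyFaithful_i := e.symm.fullyFaithfulFunctor.comp hff
      fullyFaithful_s := t.fullyFaithfulEquiv.symm hr
      fullyFaithful_r := hr
      essImage_i_iff := fun X => by
        rw [isZero_cornerFunctor_sinkHom_iff, ← essImage_restrictScalars_killHom_iff]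
        constructor
        · rintro ⟨N, hN⟩
          exact ⟨_, hN⟩
        -- Precomposing with an equivalence does not change the essential image: replace N by its
        -- image under `e`.
        · rintro ⟨N, ⟨f⟩⟩
          exact ⟨e.functor.obj N, ⟨(ModuleCat.restrictScalars π).mapIso (e.unitIso.app N).symm ≪≫
            f⟩⟩ }⟩

end DirectedGraph

theorem corollary2 (K : Type w) [Field K] (E : DirectedGraph.{u, v})
    [Finite E.Vert] [Finite E.Edge] :
    Nonempty (Recollement
      (ModuleCat.{max u v w} (E.removeSourcesSinks.LeavittPathAlgebra K))
      (ModuleCat.{max u v w} (E.LeavittPathAlgebra K))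
      (ModuleCat.{max u v w} ({x : E.Vert // E.IsSink x} → K))) :=
  DirectedGraph.nonempty_recollement K E
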